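/- Let $0<\theta<1$. Let $S=(S(t))_{t\ge0}$ be a driftless subordinator on a probability space $(\Omega,P)$ (started at $0$, with a.s. non-decreasing right-continuous paths and stationary independent increments) whose Lévy measure $\sigma$ on $(0,\infty)$ satisfies $\int(1\wedge\tau)\,d\sigma(\tau)<\infty$ and $\sigma(0,\infty)=\infty$, so that $\mathbb E[e^{-\lambda S(t)}]=e^{-t\Phi(\lambda)}$ with $\Phi(\lambda)=\int_{(0,\infty)}(1-e^{-\lambda\tau})\,d\sigma(\tau)$ for $\lambda\ge 0$. Assume that the kernel $k(t)=\sigma((t,\infty))$ has Laplace transform $$\mathcal K(\lambda)=\int_0^\infty e^{-\lambda t}k(t)\,dt=\lambda^{\theta-1},\qquad \lambda>0$$ (the $\theta$-stable, or Caputo–Djrbashian, case). Let $E(t)=\inf\{s\ge0: S(s)\ge t\}$ be the inverse process, $G_t$ the density of $E(t)$ with respect to Lebesgue measure, $v(x,t)=(2\pi t)^{-d/2}e^{-|x|^2/(2t)}$ the Gaussian heat kernel on $\mathbb R^d$, and $$v^E(x,t)=\int_0^\infty v(x,\tau)G_t(\tau)\,d\tau,\qquad M_t\big(v^E(x,t)\big)=\frac1t\int_0^t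 v^E(x,s)\,ds .$$ Let $K_\nu$ be the modified Bessel function of the second kind. Then $E(t)$ has a density for every $t>0$. If $d=1$, or $d\ge2$ and $x\ne0$, then for every $t>0$ the two integrals above converge. Moreover there are constants $C_1,C_2>0$, depending only on $\theta$, and $A_d,B_d>0$ for $d\ge3$, depending only on $d$ and $\theta$, such that for each fixed $x\in\mathbb R^d$, as $t\to\infty$ (where $f\sim g$ means that the ratio tends to $1$): 1. if $d=1$, $$M_t\big(v^E(x,t)\big)\sim C_1t^{-\theta/2}e^{-\sqrt2|x|t^{-\theta/2}}\sim C_1t^{-\theta/2};$$ 2. if $d=2$ and $x\neq0$, $$M_t\big(v^E(x,t)\big)\sim C_2t^{-\theta}K_0\big(\sqrt2|x|t^{-\theta/2}\big)\sim -C_2t^{-\theta}\ln\big(\sqrt2|x|t^{-\theta/2}\big);$$ 3. if $d\ge3$ and $x\neq0$, $$M_t\big(v^E(x,t)\big)\sim A_d\,t^{-\theta}\,|x|^{(2-d)/2}\,t^{\theta(2-d)/4}K_{\frac d2-1}\big(\sqrt2|x|t^{-\theta/2}\big)\sim B_d\,|x|^{2-d}\,t^{-\theta}.$$ -/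

import Mathlib

open MeasureTheory ProbabilityTheory Filter Set Asymptotics
open scoped NNReal ENNReal Topology

/-- `σ` is a Lévy measure of a subordinator with infinite activity: a measure carried by `(0, ∞)`
with `∫ (1 ∧ τ) dσ(τ) < ∞` and `σ (0, ∞) = ∞`. -/
structure IsInfiniteLevyMeasure (σ : Measure ℝ) : Prop where
  carrier : σ (Iic 0) = 0
  lintegral_min_lt_top : ∫⁻ τ, ENNReal.ofReal (min 1 τ) ∂σ < ∞
  mass_eq_top : σ (Ioi 0) = ∞

/-- The (driftless) Laplace exponent `Φ(λ) = ∫_{(0,∞)} (1 - e^{-λτ}) dσ(τ)`. -/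
noncomputable def laplaceExponent (σ : Measure ℝ) (l : ℝ) : ℝ :=
  ∫ τ in Ioi 0, (1 - Real.exp (-(l * τ))) ∂σ

/-- The kernel `k(t) = σ((t, ∞))`. -/
noncomputable def levyKernel (σ : Measure ℝ) (t : ℝ) : ℝ :=
  (σ (Ioi t)).toReal

/-- The Laplace transform `𝒦(λ) = ∫₀^∞ e^{-λt} k(t) dt` of the kernel `k`. -/
noncomputable def kernelLaplace (σ : Measure ℝ) (l : ℝ) : ℝ :=
  ∫ t in Ioi 0, Real.exp (-(l * t)) * levyKernel σ t

/-- `S` is a driftless subordinator with Lévy measure `σ` on the probability space `(Ω, P)`: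
a process started at `0`, with almost surely non-decreasing right-continuous paths, independent
and stationary increments, and `𝔼[e^{-λ S(t)}] = e^{-t Φ(λ)}`. -/
structure IsSubordinator {Ω : Type*} [MeasurableSpace Ω] (P : Measure Ω) (S : ℝ≥0 → Ω → ℝ)
    (σ : Measure ℝ) : Prop where
  levy : IsInfiniteLevyMeasure σ
  measurable : ∀ t, Measurable (S t)
  start : ∀ᵐ ω ∂P, S 0 ω = 0
  monotone : ∀ᵐ ω ∂P, Monotone fun t => S t ω
  rightCts : ∀ᵐ ω ∂P, ∀ t, ContinuousWithinAt (fun s => S s ω) (Ici t) t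
  indep : HasIndepIncrements S P
  stationary : ∀ s t, IdentDistrib (fun ω => S (s + t) ω - S s ω) (S t) P P
  laplace : ∀ (t : ℝ≥0) (l : ℝ), 0 ≤ l →
    ∫ ω, Real.exp (-(l * S t ω)) ∂P = Real.exp (-(t * laplaceExponent σ l))

/-- The inverse process `E(t) = inf {s ≥ 0 : S(s) ≥ t}`. -/
noncomputable def inverseProcess {Ω : Type*} (S : ℝ≥0 → Ω → ℝ) (t : ℝ) (ω : Ω) : ℝ :=
  (sInf {s : ℝ≥0 | t ≤ S s ω} : ℝ≥0)

/-- `G_t(τ)`, the density at `τ` of the law of `E(t)` with respect to Lebesgue measure. -/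
noncomputable def inverseDensity {Ω : Type*} [MeasurableSpace Ω] (P : Measure Ω)
    (S : ℝ≥0 → Ω → ℝ) (t τ : ℝ) : ℝ :=
  ((P.map (inverseProcess S t)).rnDeriv volume τ).toReal

/-- The Gaussian heat kernel `v(x,t) = (2πt)^{-d/2} e^{-|x|²/(2t)}` on `ℝ^d`. -/
noncomputable def heatKernel {d : ℕ} (x : EuclideanSpace ℝ (Fin d)) (t : ℝ) : ℝ :=
  1 / (2 * Real.pi * t) ^ ((d : ℝ) / 2) * Real.exp (-(‖x‖ ^ 2 / (2 * t)))

/-- The subordinated heat kernel `v^E(x,t) = ∫₀^∞ v(x,τ) G_t(τ) dτ`. -/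
noncomputable def subordinatedKernel {Ω : Type*} [MeasurableSpace Ω] (P : Measure Ω)
    (S : ℝ≥0 → Ω → ℝ) {d : ℕ} (x : EuclideanSpace ℝ (Fin d)) (t : ℝ) : ℝ :=
  ∫ τ in Ioi 0, heatKernel x τ * inverseDensity P S t τ

/-- The Cesàro mean `M_t(f) = t⁻¹ ∫₀ᵗ f(s) ds`. -/
noncomputable def cesaroMean (f : ℝ → ℝ) (t : ℝ) : ℝ :=
  1 / t * ∫ s in (0 : ℝ)..t, f s

/-- The modified Bessel function of the second kind, for real order `ν` and argument `z > 0`: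
`K_ν(z) = ∫₀^∞ e^{-z cosh u} cosh(νu) du`. -/
noncomputable def besselK (ν z : ℝ) : ℝ :=
  ∫ u in Ioi 0, Real.exp (-(z * Real.cosh u)) * Real.cosh (ν * u)

/-!
The proof takes Laplace transforms in time and returns by a Tauberian theorem.

The hypothesis on the kernel gives `Φ(l) = l 𝒦(l) = l ^ θ`, so `𝔼 e^{-l S(r)} = e^{-r l^θ}`. Since
paths are non-decreasing and right-continuous, `E(t) ≤ r` if and only if `t ≤ S(r)`, almost surely
(`IsSubordinator.inverseProcess_le_iff`), and the layer-cake formula shows that the measure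
`∫₀^∞ l e^{-lt} Law(E(t)) dt` is exponential of rate `l ^ θ`
(`IsSubordinator.bind_map_inverseProcess`). Hence the Laplace transform in time of `v^E(x, ·)` is
`l^{θ-1} H(l^θ)`, where `H(u) = ∫₀^∞ e^{-uτ} v(x, τ) dτ` is the Laplace transform of the heat
kernel.

Karamata's theorem (`karamata_tauberian`) converts regular variation of `H` at `0` into
`M_t(v^E) ~ t^{-θ} H(t^{-θ}) / Γ(2 - θ + θα)`, where `-α` is the index of `H`
(`IsSubordinator.cesaroMean_isEquivalent`). Here `H(u)` is asymptotic to `(2u)^{-1/2}` if `d = 1`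
(`tendsto_heatLaplace_one`), has a finite limit proportional to `‖x‖^{2-d}` if `d ≥ 3`
(`tendsto_heatLaplace_of_three_le`, `integral_heatKernel`), and for all `d` and `x ≠ 0` is an
explicit factor times `K_{d/2-1}(√(2u) ‖x‖)` (`heatLaplace_eq_besselK`), which for `d = 2` grows
logarithmically (`besselK_zero_isEquivalent`).

For the existence of a density of `E(t)`, consider `𝔼 e^{z S(1)}`, which is analytic in the left
half-plane, where it equals `exp(-(-z)^θ)`. On the line `Re z = -1` it is integrable, and it is
there the characteristic function of the law of `S(1)` tilted by `e^{-x}`; so the law of `S(1)` has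
a density (`map_absolutelyContinuous_of_stable`). By self-similarity `E(t)` is distributed as
`(t / S(1))^θ`, which transfers the density
(`IsSubordinator.map_inverseProcess_absolutelyContinuous`).
-/

/-! ### The Laplace exponent and the kernel -/

lemma IsInfiniteLevyMeasure.measure_Ioi_lt_top {σ : Measure ℝ} (hσ : IsInfiniteLevyMeasure σ)
    {t : ℝ} (ht : 0 < t) : σ (Ioi t) < ∞ := by
  have h1 : ENNReal.ofReal (min 1 t) * σ {τ | ENNReal.ofReal (min 1 t) ≤ ENNReal.ofReal (min 1 τ)}
      ≤ ∫⁻ τ, ENNReal.ofReal (min 1 τ) ∂σ :=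
    mul_meas_ge_le_lintegral (by fun_prop) _
  have h2 : σ {τ | ENNReal.ofReal (min 1 t) ≤ ENNReal.ofReal (min 1 τ)} < ∞ := by
    by_contra h
    rw [not_lt, top_le_iff] at h
    rw [h, ENNReal.mul_top (by simpa using ht)] at h1
    exact absurd hσ.lintegral_min_lt_top (not_lt.2 h1)
  refine lt_of_le_of_lt (measure_mono fun τ hτ => ?_) h2
  exact ENNReal.ofReal_le_ofReal (min_le_min le_rfl (le_of_lt hτ))

lemma measurable_measure_Ioi (σ : Measure ℝ) : Measurable (fun t => σ (Ioi t)) :=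
  Antitone.measurable fun _ _ h => measure_mono (Ioi_subset_Ioi h)

/-- The truncated exponential integral `∫₀ˣ l e^{-ls} ds`. -/
lemma integral_mul_exp_neg_mul (l x : ℝ) :
    ∫ t in (0 : ℝ)..x, l * Real.exp (-(l * t)) = 1 - Real.exp (-(l * x)) := by
  have : ∀ t ∈ uIcc 0 x, HasDerivAt (fun t => -Real.exp (-(l * t)))
      (l * Real.exp (-(l * t))) t := by
    intro t _
    have h1 : HasDerivAt (fun t : ℝ => -(l * t)) (-l) t := by
      exact (((hasDerivAt_id t).const_mul l).neg).congr_deriv (by ring)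
    exact h1.exp.neg.congr_deriv (by ring)
  rw [intervalIntegral.integral_eq_sub_of_hasDerivAt this
    (Continuous.intervalIntegrable (by fun_prop) _ _)]
  simp; ring

/-- Integration by parts: `Φ(l) = l 𝒦(l)`. -/
lemma laplaceExponent_eq_mul_kernelLaplace {σ : Measure ℝ} (hσ : IsInfiniteLevyMeasure σ)
    {l : ℝ} (hl : 0 < l) : laplaceExponent σ l = l * kernelLaplace σ l := by
  have hpos : ∀ᵐ τ ∂σ.restrict (Ioi 0), (0 : ℝ) < τ := ae_restrict_mem measurableSet_Ioi
  have h := lintegral_comp_eq_lintegral_meas_lt_mul (f := fun τ : ℝ => τ)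
    (g := fun t => l * Real.exp (-(l * t))) (σ.restrict (Ioi 0))
    (by filter_upwards [hpos] with τ hτ using hτ.le) aemeasurable_id
    (fun t _ => Continuous.intervalIntegrable (by fun_prop) _ _)
    (Eventually.of_forall fun t => by positivity)
  unfold laplaceExponent kernelLaplace
  rw [integral_eq_lintegral_of_nonneg_ae (by
      filter_upwards [hpos] with τ hτ
      have : 0 < l * τ := by positivity
      simpa using this.le) (by fun_prop),
    ← integral_const_mul, integral_eq_lintegral_of_nonneg_ae
      (Eventually.of_forall fun t => by unfold levyKernel; positivity)
      (by
        have : Measurable (levyKernel σ) := (measurable_measure_Ioi σ).ennreal_toReal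
        fun_prop)]
  congr 1
  simp_rw [integral_mul_exp_neg_mul] at h
  rw [h]
  refine setLIntegral_congr_fun measurableSet_Ioi fun t ht => ?_
  have ht0 : (0 : ℝ) < t := ht
  have hset : σ.restrict (Ioi 0) {a | t < a} = σ (Ioi t) := by
    change σ.restrict (Ioi 0) (Ioi t) = _
    rw [Measure.restrict_apply measurableSet_Ioi]
    congr 1
    ext a
    simp only [mem_inter_iff, mem_Ioi, and_iff_left_iff_imp]
    exact fun h => ht0.trans h
  rw [hset, ← mul_assoc, mul_comm, levyKernel,
    ENNReal.ofReal_mul (q := (σ (Ioi t)).toReal) (by positivity),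
    ENNReal.ofReal_toReal (hσ.measure_Ioi_lt_top ht0).ne]

/-! ### Sample paths of the subordinator and of its inverse -/

section Paths

variable {Ω : Type*} [MeasurableSpace Ω] {P : Measure Ω} {S : ℝ≥0 → Ω → ℝ} {σ : Measure ℝ} {θ : ℝ}

lemma IsSubordinator.integral_exp (hS : IsSubordinator P S σ)
    (hK : ∀ l : ℝ, 0 < l → kernelLaplace σ l = l ^ (θ - 1)) (r : ℝ≥0) {l : ℝ} (hl : 0 < l) :
    ∫ ω, Real.exp (-(l * S r ω)) ∂P = Real.exp (-(r * l ^ θ)) := by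
  rw [hS.laplace r l hl.le, laplaceExponent_eq_mul_kernelLaplace hS.levy hl, hK l hl]
  congr 3
  rw [Real.rpow_sub_one hl.ne']
  field_simp

lemma IsSubordinator.nonneg (hS : IsSubordinator P S σ) : ∀ᵐ ω ∂P, ∀ r, 0 ≤ S r ω := by
  filter_upwards [hS.start, hS.monotone] with ω h0 hm r
  have : S 0 ω ≤ S r ω := hm zero_le
  rwa [h0] at this

lemma IsSubordinator.integrable_exp [IsProbabilityMeasure P] (hS : IsSubordinator P S σ) (r : ℝ≥0)
    {l : ℝ} (hl : 0 ≤ l) : Integrable (fun ω => Real.exp (-(l * S r ω))) P := by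
  refine Integrable.of_bound ?_ 1 ?_
  · have := hS.measurable r
    fun_prop
  · filter_upwards [hS.nonneg] with ω h
    rw [Real.norm_of_nonneg (Real.exp_nonneg _), Real.exp_le_one_iff]
    have := mul_nonneg hl (h r)
    linarith

/-- Almost every path is unbounded, by Markov's inequality for `e^{-S(n)}`, whose mean is
`e^{-n}`. -/
lemma IsSubordinator.unbounded [IsProbabilityMeasure P] (hS : IsSubordinator P S σ)
    (hK : ∀ l : ℝ, 0 < l → kernelLaplace σ l = l ^ (θ - 1)) :
    ∀ᵐ ω ∂P, ∀ t : ℝ, ∃ r, t ≤ S r ω := by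
  have key : ∀ N : ℕ, ∀ᵐ ω ∂P, ∃ n : ℕ, (N : ℝ) < S n ω := by
    intro N
    have hb : ∀ n : ℕ, P.real {ω | ∀ n : ℕ, S n ω ≤ N} ≤ Real.exp N * Real.exp (-(n : ℝ)) := by
      intro n
      have h1 := mul_meas_ge_le_integral_of_nonneg (μ := P) (f := fun ω => Real.exp (-(1 * S n ω)))
        (Eventually.of_forall fun ω => Real.exp_nonneg _) (hS.integrable_exp n zero_le_one)
        (Real.exp (-(N : ℝ)))
      rw [hS.integral_exp hK n one_pos, Real.one_rpow, mul_one] at h1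
      have h2 : P.real {ω | ∀ n : ℕ, S n ω ≤ N} ≤
          P.real {ω | Real.exp (-(N : ℝ)) ≤ Real.exp (-(1 * S n ω))} := by
        refine measureReal_mono fun ω hω => ?_
        have := hω n
        simp only [mem_ofPred_eq, Real.exp_le_exp]
        linarith
      calc P.real {ω | ∀ n : ℕ, S n ω ≤ N}
          = Real.exp N * (Real.exp (-(N : ℝ)) * P.real {ω | ∀ n : ℕ, S n ω ≤ N}) := by
            rw [← mul_assoc, ← Real.exp_add]; simp
        _ ≤ Real.exp N * Real.exp (-(n : ℝ)) := by
            gcongr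
            refine le_trans ?_ (h1.trans (le_of_eq (by simp)))
            gcongr
    have hlim : Tendsto (fun n : ℕ => Real.exp N * Real.exp (-(n : ℝ))) atTop (𝓝 0) := by
      rw [← mul_zero (Real.exp N)]
      exact (Real.tendsto_exp_neg_atTop_nhds_zero.comp tendsto_natCast_atTop_atTop).const_mul _
    have h0 : P.real {ω | ∀ n : ℕ, S n ω ≤ N} ≤ 0 := ge_of_tendsto' hlim hb
    rw [ae_iff]
    have := le_antisymm h0 measureReal_nonneg
    rw [measureReal_eq_zero_iff] at this
    simpa using this
  rw [← ae_all_iff] at key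
  filter_upwards [key] with ω h t
  obtain ⟨N, hN⟩ := exists_nat_ge t
  obtain ⟨n, hn⟩ := h N
  exact ⟨n, hN.trans hn.le⟩

/-- The inverse process is a Galois adjoint of the subordinator: the infimum defining `E(t)` is
attained because paths are right-continuous. -/
lemma IsSubordinator.inverseProcess_le_iff [IsProbabilityMeasure P] (hS : IsSubordinator P S σ)
    (hK : ∀ l : ℝ, 0 < l → kernelLaplace σ l = l ^ (θ - 1)) :
    ∀ᵐ ω ∂P, ∀ (t : ℝ) (r : ℝ≥0), inverseProcess S t ω ≤ r ↔ t ≤ S r ω := by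
  filter_upwards [hS.unbounded hK, hS.monotone, hS.rightCts] with ω hu hm hc t r
  have hne : {s : ℝ≥0 | t ≤ S s ω}.Nonempty := hu t
  unfold inverseProcess
  rw [NNReal.coe_le_coe]
  constructor
  · intro h
    refine le_trans ?_ (hm h)
    refine ge_of_tendsto (x := 𝓝[>] sInf {s : ℝ≥0 | t ≤ S s ω})
      ((hc _).mono Ioi_subset_Ici_self).tendsto ?_
    filter_upwards [self_mem_nhdsWithin] with s hs
    obtain ⟨u, hu1, hu2⟩ := exists_lt_of_csInf_lt hne hs
    exact le_trans hu1 (hm hu2.le)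
  · intro h
    exact csInf_le (OrderBot.bddBelow _) h

lemma inverseProcess_nonneg {Ω : Type*} {S : ℝ≥0 → Ω → ℝ} (t : ℝ) (ω : Ω) :
    0 ≤ inverseProcess S t ω := NNReal.coe_nonneg _

lemma IsSubordinator.aemeasurable_inverseProcess [IsProbabilityMeasure P]
    (hS : IsSubordinator P S σ)
    (hK : ∀ l : ℝ, 0 < l → kernelLaplace σ l = l ^ (θ - 1)) (t : ℝ) :
    AEMeasurable (inverseProcess S t) P := by
  obtain ⟨A, hA, hAm, hA1⟩ := (hS.inverseProcess_le_iff hK).exists_measurable_mem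
  refine ⟨A.indicator (inverseProcess S t), ?_, ?_⟩
  · refine measurable_of_Iic fun r => ?_
    rcases lt_or_ge r 0 with hr | hr
    · convert MeasurableSet.empty
      ext ω
      simp only [mem_preimage, mem_Iic, mem_empty_iff_false, iff_false, not_le]
      exact hr.trans_le (indicator_nonneg (fun ω _ => inverseProcess_nonneg t ω) ω)
    · lift r to ℝ≥0 using hr
      have : A.indicator (inverseProcess S t) ⁻¹' Iic (r : ℝ) = Aᶜ ∪ A ∩ {ω | t ≤ S r ω} := by
        ext ω
        by_cases hω : ω ∈ A
        · simp [hω, hA1 ω hω t r]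
        · simp [hω]
      rw [this]
      exact hAm.compl.union (hAm.inter (measurableSet_le measurable_const (hS.measurable r)))
  · filter_upwards [hA] with ω hω
    simp [hω]

lemma IsSubordinator.isProbabilityMeasure_map [IsProbabilityMeasure P]
    (hS : IsSubordinator P S σ)
    (hK : ∀ l : ℝ, 0 < l → kernelLaplace σ l = l ^ (θ - 1)) (t : ℝ) :
    IsProbabilityMeasure (P.map (inverseProcess S t)) :=
  Measure.isProbabilityMeasure_map (hS.aemeasurable_inverseProcess hK t)

lemma IsSubordinator.map_inverseProcess_Iic [IsProbabilityMeasure P]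
    (hS : IsSubordinator P S σ)
    (hK : ∀ l : ℝ, 0 < l → kernelLaplace σ l = l ^ (θ - 1)) (t : ℝ) (r : ℝ≥0) :
    P.map (inverseProcess S t) (Iic r) = P {ω | t ≤ S r ω} := by
  rw [Measure.map_apply_of_aemeasurable (hS.aemeasurable_inverseProcess hK t) measurableSet_Iic]
  refine measure_congr ?_
  filter_upwards [hS.inverseProcess_le_iff hK] with ω h
  exact propext (h t r)

lemma map_inverseProcess_Iic_of_neg {r : ℝ} (hr : r < 0) (t : ℝ) :
    P.map (inverseProcess S t) (Iic r) = 0 := by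
  by_cases h : AEMeasurable (inverseProcess S t) P
  · rw [Measure.map_apply_of_aemeasurable h measurableSet_Iic]
    have : inverseProcess S t ⁻¹' Iic r = ∅ := by
      ext ω
      simpa using hr.trans_le (inverseProcess_nonneg t ω)
    rw [this, measure_empty]
  · simp [Measure.map_of_not_aemeasurable h]

/-- For `t > 0` the law of `E(t)` is carried by `(0, ∞)`, because `S(0) = 0`. -/
lemma IsSubordinator.ae_map_pos [IsProbabilityMeasure P]
    (hS : IsSubordinator P S σ)
    (hK : ∀ l : ℝ, 0 < l → kernelLaplace σ l = l ^ (θ - 1)) {t : ℝ} (ht : 0 < t) :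
    ∀ᵐ τ ∂P.map (inverseProcess S t), τ ∈ Ioi (0 : ℝ) := by
  have : P.map (inverseProcess S t) (Iic ((0 : ℝ≥0) : ℝ)) = 0 := by
    rw [hS.map_inverseProcess_Iic hK]
    have h : ∀ᵐ ω ∂P, ¬ t ≤ S 0 ω := by
      filter_upwards [hS.start] with ω h
      rw [h, not_le]
      exact ht
    simpa [ae_iff] using h
  rw [ae_iff]
  convert this using 2
  ext τ
  simp

lemma IsSubordinator.measurable_map [IsProbabilityMeasure P]
    (hS : IsSubordinator P S σ)
    (hK : ∀ l : ℝ, 0 < l → kernelLaplace σ l = l ^ (θ - 1)) :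
    Measurable (fun t => P.map (inverseProcess S t)) := by
  have := hS.isProbabilityMeasure_map hK
  refine Measurable.measure_of_isPiSystem_of_isProbabilityMeasure
    (borel_eq_generateFrom_Iic ℝ ▸ BorelSpace.measurable_eq) isPiSystem_Iic ?_
  rintro _ ⟨r, rfl⟩
  rcases lt_or_ge r 0 with hr | hr
  · simp only [map_inverseProcess_Iic_of_neg hr]
    exact measurable_const
  · lift r to ℝ≥0 using hr
    simp only [hS.map_inverseProcess_Iic hK]
    exact Antitone.measurable fun s t h => measure_mono fun ω hω => le_trans h hω

/-- Layer-cake form of `∫₀^∞ e^{-lt} P(S(r) ≥ t) dt = (1 - 𝔼 e^{-l S(r)}) / l`. -/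
lemma IsSubordinator.lintegral_exp_mul_measure [IsProbabilityMeasure P]
    (hS : IsSubordinator P S σ)
    (hK : ∀ l : ℝ, 0 < l → kernelLaplace σ l = l ^ (θ - 1)) {l : ℝ} (hl : 0 < l) (r : ℝ≥0) :
    ∫⁻ t in Ioi 0, ENNReal.ofReal (l * Real.exp (-(l * t))) * P {ω | t ≤ S r ω} =
      ENNReal.ofReal (1 - Real.exp (-(r * l ^ θ))) := by
  have h := lintegral_comp_eq_lintegral_meas_le_mul (f := S r)
    (g := fun t => l * Real.exp (-(l * t))) P
    (by filter_upwards [hS.nonneg] with ω h using h r) (hS.measurable r).aemeasurable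
    (fun t _ => Continuous.intervalIntegrable (by fun_prop) _ _)
    (Eventually.of_forall fun t => by positivity)
  simp_rw [integral_mul_exp_neg_mul] at h
  simp_rw [mul_comm (ENNReal.ofReal (l * Real.exp _))]
  have hi : Integrable (fun ω => 1 - Real.exp (-(l * S r ω))) P :=
    (integrable_const _).sub (hS.integrable_exp r hl.le)
  rw [← h, ← ofReal_integral_eq_lintegral_ofReal hi,
    integral_sub (integrable_const _) (hS.integrable_exp r hl.le), hS.integral_exp hK r hl]
  · simp
  · filter_upwards [hS.nonneg] with ω h
    have := mul_nonneg hl.le (h r)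
    simpa using this

/-- The Laplace transform in time of the laws of `E(t)`: the measure
`∫₀^∞ l e^{-lt} Law(E(t)) dt` is exponential with rate `l ^ θ`. -/
lemma IsSubordinator.bind_map_inverseProcess [IsProbabilityMeasure P]
    (hS : IsSubordinator P S σ)
    (hK : ∀ l : ℝ, 0 < l → kernelLaplace σ l = l ^ (θ - 1)) {l : ℝ} (hl : 0 < l) :
    ((volume.restrict (Ioi 0)).withDensity fun t => ENNReal.ofReal (l * Real.exp (-(l * t)))).bind
      (fun t => P.map (inverseProcess S t)) =
    (volume.restrict (Ioi 0)).withDensity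
      fun τ => ENNReal.ofReal (l ^ θ * Real.exp (-(l ^ θ * τ))) := by
  have hm := hS.measurable_map hK
  have hp := hS.isProbabilityMeasure_map hK
  have hlθ : 0 < l ^ θ := Real.rpow_pos_of_pos hl θ
  have key : ∀ a : ℝ, ((volume.restrict (Ioi 0)).withDensity
      fun τ => ENNReal.ofReal (l ^ θ * Real.exp (-(l ^ θ * τ)))) (Iic a) =
      ENNReal.ofReal (1 - Real.exp (-(l ^ θ * max a 0))) := by
    intro a
    rw [withDensity_apply _ measurableSet_Iic, Measure.restrict_restrict measurableSet_Iic,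
      inter_comm, Ioi_inter_Iic]
    rcases le_or_gt a 0 with ha | ha
    · simp [Ioc_eq_empty (not_lt.2 ha), max_eq_right ha]
    · rw [max_eq_left ha.le, ← integral_mul_exp_neg_mul,
        intervalIntegral.integral_of_le ha.le, ofReal_integral_eq_lintegral_ofReal]
      · exact Continuous.integrableOn_Ioc (by fun_prop)
      · exact Eventually.of_forall fun t => by positivity
  symm
  have : IsFiniteMeasure ((volume.restrict (Ioi 0)).withDensity
      fun τ => ENNReal.ofReal (l ^ θ * Real.exp (-(l ^ θ * τ)))) := by
    refine isFiniteMeasure_withDensity_ofReal ?_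
    refine Integrable.hasFiniteIntegral ?_
    have := (integrableOn_exp_mul_Ioi (neg_lt_zero.2 hlθ) 0).const_mul (l ^ θ)
    simpa [neg_mul] using this
  refine Measure.ext_of_Iic _ _ fun a => ?_
  have hma : Measurable fun t => P.map (inverseProcess S t) (Iic a) :=
    (Measure.measurable_coe measurableSet_Iic).comp hm
  rw [key, Measure.bind_apply measurableSet_Iic hm.aemeasurable,
    lintegral_withDensity_eq_lintegral_mul _ (by fun_prop) hma]
  rcases lt_or_ge a 0 with ha | ha
  · simp [map_inverseProcess_Iic_of_neg ha, max_eq_right ha.le]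
  · lift a to ℝ≥0 using ha
    simp only [Pi.mul_apply, hS.map_inverseProcess_Iic hK]
    rw [hS.lintegral_exp_mul_measure hK hl, max_eq_left (NNReal.coe_nonneg a), mul_comm]

/-- The law of `E(t)` is stochastically increasing in `t`. -/
lemma IsSubordinator.lintegral_map_antitone [IsProbabilityMeasure P]
    (hS : IsSubordinator P S σ)
    (hK : ∀ l : ℝ, 0 < l → kernelLaplace σ l = l ^ (θ - 1)) {f : ℝ → ℝ≥0∞} (hf : Measurable f)
    (hanti : AntitoneOn f (Ioi 0)) {s t : ℝ} (hs : 0 < s) (hst : s ≤ t) :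
    ∫⁻ τ, f τ ∂P.map (inverseProcess S t) ≤ ∫⁻ τ, f τ ∂P.map (inverseProcess S s) := by
  have hE := hS.aemeasurable_inverseProcess hK
  rw [lintegral_map' hf.aemeasurable (hE t), lintegral_map' hf.aemeasurable (hE s)]
  refine lintegral_mono_ae ?_
  filter_upwards [hS.inverseProcess_le_iff hK, ae_of_ae_map (hE s) (hS.ae_map_pos hK hs),
    ae_of_ae_map (hE t) (hS.ae_map_pos hK (hs.trans_le hst))] with ω h h1 h2
  refine hanti h1 h2 ?_
  have h3 := (h t ⟨inverseProcess S t ω, inverseProcess_nonneg t ω⟩).1 le_rfl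
  exact (h s ⟨inverseProcess S t ω, inverseProcess_nonneg t ω⟩).2 (hst.trans h3)

end Paths

/-! ### Measures with an integrable characteristic function -/

open scoped FourierTransform in
/-- Parseval's relation for a Schwartz function against a measure, with the bound
`‖𝓕⁻ h‖_∞ ≤ ‖h‖₁`. -/
lemma norm_integral_le_of_integrable_charFun {ν : Measure ℝ} [IsFiniteMeasure ν]
    (hν : Integrable (charFun ν)) (h : SchwartzMap ℝ ℂ) :
    ‖∫ x, h x ∂ν‖ ≤ (∫ x, ‖charFun ν (x * (-(2 * Real.pi)))‖) * ∫ x, ‖h x‖ := by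
  have hF : (𝓕 (𝓕⁻ h) : SchwartzMap ℝ ℂ) = h := FourierInvPair.fourier_fourierInv_eq h
  have hb : ∀ w : ℝ, ‖(𝓕⁻ h : SchwartzMap ℝ ℂ) w‖ ≤ ∫ x, ‖h x‖ := fun w => by
    rw [SchwartzMap.fourierInv_coe, Real.fourierInv_eq_fourier_neg]
    exact VectorFourier.norm_fourierIntegral_le_integral_norm _ _ _ _ _
  have hflip := VectorFourier.integral_fourierIntegral_smul_eq_flip (μ := volume) (ν := ν)
    (L := innerₗ ℝ) (f := (𝓕⁻ h : SchwartzMap ℝ ℂ)) (g := fun _ => (1 : ℂ))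
    Real.continuous_fourierChar (by exact continuous_inner)
    (𝓕⁻ h : SchwartzMap ℝ ℂ).integrable (integrable_const _)
  have h1 : ∀ x, VectorFourier.fourierIntegral Real.fourierChar volume (innerₗ ℝ)
      (𝓕⁻ h : SchwartzMap ℝ ℂ) x = h x := fun x => by
    conv_rhs => rw [← hF, SchwartzMap.fourier_coe]
    rfl
  have h2 : ∀ x, VectorFourier.fourierIntegral Real.fourierChar ν (innerₗ ℝ).flip
      (fun _ => (1 : ℂ)) x = charFun ν (x * (-(2 * Real.pi))) := fun x => by
    rw [charFun_apply_real, VectorFourier.fourierIntegral]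
    refine integral_congr_ae (Eventually.of_forall fun v => ?_)
    simp only [Circle.smul_def, Real.fourierChar_apply, smul_eq_mul, mul_one]
    congr 1
    simp
    ring
  simp only [h1, h2, smul_eq_mul, mul_one] at hflip
  have hi : Integrable fun x => charFun ν (x * (-(2 * Real.pi))) :=
    hν.comp_mul_right' (by simp [Real.pi_ne_zero])
  calc ‖∫ x, h x ∂ν‖
      = ‖∫ x, (𝓕⁻ h : SchwartzMap ℝ ℂ) x * charFun ν (x * (-(2 * Real.pi)))‖ := by rw [hflip]
    _ ≤ ∫ x, ‖charFun ν (x * (-(2 * Real.pi)))‖ * ∫ x, ‖h x‖ := by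
        refine norm_integral_le_of_norm_le (hi.norm.mul_const _) (Eventually.of_forall fun x => ?_)
        rw [norm_mul, mul_comm]
        gcongr
        exact hb x
    _ = _ := integral_mul_const _ _

/-- Testing against smooth bump functions of a null compact set shows that a finite measure with
integrable characteristic function has a density. -/
theorem absolutelyContinuous_of_integrable_charFun {ν : Measure ℝ} [IsFiniteMeasure ν]
    (hν : Integrable (charFun ν)) : ν ≪ volume := by
  set C : ℝ := ∫ x, ‖charFun ν (x * (-(2 * Real.pi)))‖ with hC
  have hC0 : 0 ≤ C := integral_nonneg fun _ => norm_nonneg _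
  have hcompact : ∀ K : Set ℝ, IsCompact K → volume K = 0 → ν K = 0 := by
    intro K hK hK0
    have hle : ∀ ε : ℝ, 0 < ε → ν.real K ≤ C * ε := by
      intro ε hε
      obtain ⟨U, hKU, hU, hUε⟩ := Set.exists_isOpen_lt_of_lt (μ := (volume : Measure ℝ)) K
        (ENNReal.ofReal ε) (by rw [hK0]; simpa using hε)
      obtain ⟨K', hK', hKK'⟩ := exists_compact_superset hK
      obtain ⟨f, hf, hr, hs, h1⟩ := exists_contMDiff_support_eq_eq_one_iff
        (modelWithCornersSelf ℝ ℝ) (n := ⊤) (hU.inter isOpen_interior) hK.isClosed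
        (subset_inter hKU hKK')
      have hf0 : ∀ x, 0 ≤ f x := fun x => (hr ⟨x, rfl⟩).1
      have hf1 : ∀ x, f x ≤ 1 := fun x => (hr ⟨x, rfl⟩).2
      have hsupp : HasCompactSupport f := by
        refine HasCompactSupport.intro hK' fun x hx => ?_
        have : x ∉ Function.support f := by
          rw [hs]
          exact fun h => hx (interior_subset h.2)
        simpa using this
      have hfc : HasCompactSupport (fun x => (f x : ℂ)) :=
        hsupp.comp_left (g := Complex.ofReal) Complex.ofReal_zero
      have hfs : ContDiff ℝ (⊤ : ℕ∞) (fun x => (f x : ℂ)) :=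
        Complex.ofRealCLM.contDiff.comp hf.contDiff
      have hfi : ∀ μ : Measure ℝ, [IsFiniteMeasureOnCompacts μ] → Integrable f μ := fun μ _ =>
        hf.continuous.integrable_of_hasCompactSupport hsupp
      have key := norm_integral_le_of_integrable_charFun hν (hfc.toSchwartzMap hfs)
      have hcoe : ∀ x, hfc.toSchwartzMap hfs x = (f x : ℂ) := fun x => rfl
      simp only [hcoe, integral_complex_ofReal, Complex.norm_real] at key
      calc ν.real K = ∫ x, K.indicator (fun _ => (1 : ℝ)) x ∂ν := by
            rw [integral_indicator_const _ hK.measurableSet]; simp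
        _ ≤ ∫ x, f x ∂ν := by
            refine integral_mono ((integrable_const 1).indicator hK.measurableSet) (hfi ν) ?_
            intro x
            by_cases hx : x ∈ K
            · simp [hx, ((h1 x).1 hx)]
            · simp [hx, hf0 x]
        _ ≤ C * ∫ x, ‖f x‖ := (le_abs_self _).trans key
        _ ≤ C * ε := by
            gcongr
            calc ∫ x, ‖f x‖ ≤ ∫ x, (U ∩ interior K').indicator (fun _ => (1 : ℝ)) x := by
                  refine integral_mono (hfi _).norm ?_ ?_
                  · refine (integrable_indicator_iff (hU.inter isOpen_interior).measurableSet).2 ?_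
                    refine integrableOn_const ?_
                    exact ((measure_mono inter_subset_left).trans_lt
                      (hUε.trans ENNReal.ofReal_lt_top)).ne
                  · intro x
                    by_cases hx : x ∈ U ∩ interior K'
                    · simp [indicator_of_mem hx, abs_of_nonneg (hf0 x), hf1 x]
                    · rw [← hs] at hx
                      have hx0 : f x = 0 := by simpa using hx
                      simp only [hx0, norm_zero]
                      exact indicator_nonneg (fun _ _ => zero_le_one) x
              _ = volume.real (U ∩ interior K') := by
                  rw [integral_indicator_const _ (hU.inter isOpen_interior).measurableSet]; simp
              _ ≤ ε := by
                  refine ENNReal.toReal_le_of_le_ofReal hε.le ?_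
                  exact (measure_mono inter_subset_left).trans hUε.le
    have h0 : ν.real K ≤ 0 := by
      have : Tendsto (fun ε : ℝ => C * ε) (𝓝[>] 0) (𝓝 (C * 0)) :=
        (tendsto_id.const_mul C).mono_left nhdsWithin_le_nhds
      rw [mul_zero] at this
      exact ge_of_tendsto this (by filter_upwards [self_mem_nhdsWithin] with ε hε using hle ε hε)
    exact (measureReal_eq_zero_iff (by finiteness)).1 (le_antisymm h0 measureReal_nonneg)
  refine Measure.AbsolutelyContinuous.mk fun s hs hs0 => ?_
  rw [hs.measure_eq_iSup_isCompact]
  simp only [ENNReal.iSup_eq_zero]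
  exact fun K hKs hK => hcompact K hK (measure_mono_null hKs hs0)

/-! ### The stable law has a density -/

lemma isPreconnected_re_neg : IsPreconnected {z : ℂ | z.re < 0} :=
  (convex_halfSpace_re_lt 0).isPreconnected

/-- Two functions analytic on the left half-plane that agree at the negative reals are equal. -/
lemma eqOn_re_neg_of_eq_ofReal {f g : ℂ → ℂ} (hf : AnalyticOnNhd ℂ f {z | z.re < 0})
    (hg : AnalyticOnNhd ℂ g {z | z.re < 0}) (h : ∀ l : ℝ, 0 < l → f (-l : ℝ) = g (-l : ℝ)) :
    EqOn f g {z | z.re < 0} := by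
  refine hf.eqOn_of_preconnected_of_frequently_eq hg isPreconnected_re_neg
    (z₀ := ((-1 : ℝ) : ℂ)) (by simp) ?_
  have ht : Tendsto (fun x : ℝ => (x : ℂ)) (𝓝[≠] (-1)) (𝓝[≠] ((-1 : ℝ) : ℂ)) := by
    refine tendsto_nhdsWithin_of_tendsto_nhds_of_eventually_within _
      (Complex.continuous_ofReal.continuousAt.tendsto.mono_left nhdsWithin_le_nhds) ?_
    filter_upwards [self_mem_nhdsWithin] with x hx
    have hx : x ≠ -1 := hx
    exact fun h => hx (Complex.ofReal_injective h)
  refine ht.frequently (Eventually.frequently ?_)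
  have : ∀ᶠ x : ℝ in 𝓝[≠] (-1), x < 0 :=
    nhdsWithin_le_nhds (Iio_mem_nhds (by norm_num))
  filter_upwards [this] with x hx
  simpa using h (-x) (by linarith)

section Tilt

variable {Ω : Type*} [MeasurableSpace Ω] {P : Measure Ω} {X : Ω → ℝ}

lemma analyticOnNhd_complexMGF_of_nonneg [IsProbabilityMeasure P] (hX : AEMeasurable X P)
    (hX0 : ∀ᵐ ω ∂P, 0 ≤ X ω) : AnalyticOnNhd ℂ (complexMGF X P) {z | z.re < 0} := by
  refine analyticOnNhd_complexMGF.mono fun z (hz : z.re < 0) => ?_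
  refine mem_interior.2 ⟨Iio 0, fun t (ht : t < 0) => ?_, isOpen_Iio, hz⟩
  refine Integrable.of_bound (by fun_prop) 1 ?_
  filter_upwards [hX0] with ω h
  rw [Real.norm_of_nonneg (Real.exp_nonneg _), Real.exp_le_one_iff]
  nlinarith

/-- The law of `X` tilted by `e^{-x}`; its characteristic function is the Laplace transform of `X`
along the line `Re z = -1`. -/
noncomputable def tiltedLaw (P : Measure Ω) (X : Ω → ℝ) : Measure ℝ :=
  (P.map X).withDensity fun x => ENNReal.ofReal (Real.exp (-x))

lemma absolutelyContinuous_tiltedLaw : P.map X ≪ tiltedLaw P X :=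
  withDensity_absolutelyContinuous' (by fun_prop) (Eventually.of_forall fun x => by
    simpa using Real.exp_pos _)

lemma isFiniteMeasure_tiltedLaw [IsProbabilityMeasure P] (hX : AEMeasurable X P)
    (hX0 : ∀ᵐ ω ∂P, 0 ≤ X ω) : IsFiniteMeasure (tiltedLaw P X) := by
  refine isFiniteMeasure_withDensity_ofReal (Integrable.hasFiniteIntegral ?_)
  rw [integrable_map_measure (by fun_prop) hX]
  refine Integrable.of_bound (by fun_prop) 1 ?_
  filter_upwards [hX0] with ω h
  simpa [abs_of_nonneg (Real.exp_nonneg _)] using h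

lemma charFun_tiltedLaw (hX : AEMeasurable X P) (t : ℝ) :
    charFun (tiltedLaw P X) t = complexMGF X P (-1 + t * Complex.I) := by
  rw [charFun_apply_real, tiltedLaw, integral_withDensity_eq_integral_toReal_smul (by fun_prop)
    (by simp), integral_map hX (by fun_prop), complexMGF]
  refine integral_congr_ae (Eventually.of_forall fun ω => ?_)
  simp only [ENNReal.toReal_ofReal (Real.exp_nonneg _), Complex.real_smul, Complex.ofReal_exp]
  rw [← Complex.exp_add]
  congr 1
  push_cast
  ring

/-- A law on `[0, ∞)` is determined by its Laplace transform. -/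
lemma map_eq_of_laplace_eq [IsProbabilityMeasure P] {Y : Ω → ℝ}
    (hX : AEMeasurable X P) (hX0 : ∀ᵐ ω ∂P, 0 ≤ X ω)
    (hY : AEMeasurable Y P) (hY0 : ∀ᵐ ω ∂P, 0 ≤ Y ω)
    (h : ∀ l : ℝ, 0 < l → ∫ ω, Real.exp (-(l * X ω)) ∂P = ∫ ω, Real.exp (-(l * Y ω)) ∂P) :
    P.map X = P.map Y := by
  have hEq : EqOn (complexMGF X P) (complexMGF Y P) {z | z.re < 0} := by
    refine eqOn_re_neg_of_eq_ofReal (analyticOnNhd_complexMGF_of_nonneg hX hX0)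
      (analyticOnNhd_complexMGF_of_nonneg hY hY0) fun l hl => ?_
    rw [complexMGF_ofReal, complexMGF_ofReal]
    simpa [mgf, neg_mul] using h l hl
  have := isFiniteMeasure_tiltedLaw hX hX0
  have := isFiniteMeasure_tiltedLaw hY hY0
  have ht : tiltedLaw P X = tiltedLaw P Y := by
    refine Measure.ext_of_charFun (funext fun t => ?_)
    rw [charFun_tiltedLaw hX, charFun_tiltedLaw hY]
    exact hEq (by simp)
  have hinv : ∀ Z : Ω → ℝ, (tiltedLaw P Z).withDensity (fun x => ENNReal.ofReal (Real.exp x)) =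
      P.map Z := by
    intro Z
    rw [tiltedLaw, ← withDensity_mul _ (by fun_prop) (by fun_prop)]
    convert withDensity_one using 2
    ext x
    rw [Pi.mul_apply, ← ENNReal.ofReal_mul (Real.exp_nonneg _), ← Real.exp_add]
    simp
  rw [← hinv X, ← hinv Y, ht]

/-- `Re (1 - iξ)^θ ≥ cos(πθ/2) |ξ|^θ`, because `|arg (1 - iξ)| < π/2`. -/
lemma re_cpow_ge {θ : ℝ} (hθ0 : 0 < θ) (hθ1 : θ < 1) (ξ : ℝ) :
    Real.cos (θ * (Real.pi / 2)) * |ξ| ^ θ ≤ ((1 - ξ * Complex.I) ^ (θ : ℂ)).re := by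
  set w : ℂ := 1 - ξ * Complex.I with hw
  have hre : w.re = 1 := by simp [hw]
  have him : w.im = -ξ := by simp [hw]
  have hnorm : |ξ| ≤ ‖w‖ := by simpa [him] using Complex.abs_im_le_norm w
  have harg : |w.arg| ≤ Real.pi / 2 := Complex.abs_arg_le_pi_div_two_iff.2 (by rw [hre]; norm_num)
  have hpi := Real.pi_pos
  have hcos : Real.cos (θ * (Real.pi / 2)) ≤ Real.cos (w.arg * θ) := by
    rw [← Real.cos_abs (w.arg * θ), abs_mul, abs_of_pos hθ0, mul_comm |w.arg|]
    refine Real.cos_le_cos_of_nonneg_of_le_pi (by positivity) ?_ (by gcongr)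
    nlinarith
  have hcos0 : 0 ≤ Real.cos (θ * (Real.pi / 2)) := by
    refine Real.cos_nonneg_of_mem_Icc ⟨by nlinarith, by nlinarith⟩
  have hval : (w ^ (θ : ℂ)).re = ‖w‖ ^ θ * Real.cos (w.arg * θ) := by
    rw [Complex.cpow_ofReal, Complex.re_ofReal_mul]
    simp [-Complex.ofReal_mul, Complex.cos_ofReal_re, Complex.sin_ofReal_im]
  rw [hval, mul_comm]
  gcongr

lemma integrable_exp_neg_mul_abs_rpow {θ c : ℝ} (hθ : 0 < θ) (hc : 0 < c) :
    Integrable fun ξ : ℝ => Real.exp (-(c * |ξ| ^ θ)) := by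
  by_contra h
  have h1 := integral_comp_abs (f := fun x : ℝ => Real.exp (-c * x ^ θ))
  simp only [neg_mul] at h1
  rw [integral_undef h] at h1
  have h2 := integral_exp_neg_mul_rpow hθ hc
  simp only [neg_mul] at h2
  rw [h2] at h1
  have : 0 < c ^ (-1 / θ) * Real.Gamma (1 / θ + 1) :=
    mul_pos (Real.rpow_pos_of_pos hc _) (Real.Gamma_pos_of_pos (by positivity))
  linarith

/-- A nonnegative variable with Laplace transform `e^{-l^θ}` has a law with a density. -/
lemma map_absolutelyContinuous_of_stable [IsProbabilityMeasure P] (hX : AEMeasurable X P)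
    (hX0 : ∀ᵐ ω ∂P, 0 ≤ X ω) {θ : ℝ} (hθ0 : 0 < θ) (hθ1 : θ < 1)
    (h : ∀ l : ℝ, 0 < l → ∫ ω, Real.exp (-(l * X ω)) ∂P = Real.exp (-l ^ θ)) :
    P.map X ≪ volume := by
  have hEq : EqOn (complexMGF X P) (fun z => Complex.exp (-(-z) ^ (θ : ℂ))) {z | z.re < 0} := by
    refine eqOn_re_neg_of_eq_ofReal (analyticOnNhd_complexMGF_of_nonneg hX hX0) ?_ fun l hl => ?_
    · refine DifferentiableOn.analyticOnNhd ?_ (isOpen_lt Complex.continuous_re continuous_const)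
      intro z hz
      refine DifferentiableAt.differentiableWithinAt ?_
      have : -z ∈ Complex.slitPlane := Or.inl (by simpa using hz)
      exact ((differentiableAt_id.neg.cpow_const this).neg).cexp
    · rw [complexMGF_ofReal]
      have := h l hl
      simp only [mgf, neg_mul, this]
      push_cast
      rw [neg_neg, Complex.ofReal_cpow hl.le]
  have := isFiniteMeasure_tiltedLaw hX hX0
  refine absolutelyContinuous_tiltedLaw.trans (absolutelyContinuous_of_integrable_charFun ?_)
  have hc : 0 < Real.cos (θ * (Real.pi / 2)) := by
    have := Real.pi_pos
    exact Real.cos_pos_of_mem_Ioo ⟨by nlinarith, by nlinarith⟩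
  refine (integrable_exp_neg_mul_abs_rpow hθ0 hc).mono' ?_ (Eventually.of_forall fun ξ => ?_)
  · exact (continuous_charFun).aestronglyMeasurable
  · rw [charFun_tiltedLaw hX, hEq (by simp), Complex.norm_exp, Real.exp_le_exp, Complex.neg_re,
      neg_le_neg_iff]
    convert re_cpow_ge hθ0 hθ1 ξ using 3
    ring

end Tilt

/-! ### The law of the inverse process has a density -/

section InverseDensity

variable {Ω : Type*} [MeasurableSpace Ω] {P : Measure Ω} {S : ℝ≥0 → Ω → ℝ} {σ : Measure ℝ} {θ : ℝ}

lemma IsSubordinator.map_one_absolutelyContinuous [IsProbabilityMeasure P]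
    (hS : IsSubordinator P S σ) (hθ0 : 0 < θ) (hθ1 : θ < 1)
    (hK : ∀ l : ℝ, 0 < l → kernelLaplace σ l = l ^ (θ - 1)) : P.map (S 1) ≪ volume := by
  refine map_absolutelyContinuous_of_stable (hS.measurable 1).aemeasurable
    (by filter_upwards [hS.nonneg] with ω h using h 1) hθ0 hθ1 fun l hl => ?_
  simpa using hS.integral_exp hK 1 hl

lemma IsSubordinator.ae_one_pos [IsProbabilityMeasure P]
    (hS : IsSubordinator P S σ) (hθ0 : 0 < θ) (hθ1 : θ < 1)
    (hK : ∀ l : ℝ, 0 < l → kernelLaplace σ l = l ^ (θ - 1)) : ∀ᵐ ω ∂P, 0 < S 1 ω := by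
  have h0 : ∀ᵐ x ∂P.map (S 1), x ≠ 0 :=
    (hS.map_one_absolutelyContinuous hθ0 hθ1 hK).ae_le (Measure.ae_ne volume 0)
  filter_upwards [hS.nonneg, ae_of_ae_map (hS.measurable 1).aemeasurable h0] with ω h1 h2
  exact lt_of_le_of_ne (h1 1) (Ne.symm h2)

/-- Self-similarity: `S(r)` is distributed as `r^{1/θ} S(1)`. -/
lemma IsSubordinator.map_eq_scaled [IsProbabilityMeasure P]
    (hS : IsSubordinator P S σ) (hθ0 : 0 < θ)
    (hK : ∀ l : ℝ, 0 < l → kernelLaplace σ l = l ^ (θ - 1)) {r : ℝ≥0} (hr : 0 < r) :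
    P.map (S r) = P.map (fun ω => (r : ℝ) ^ (1 / θ) * S 1 ω) := by
  have hm := hS.measurable
  have hr' : 0 < (r : ℝ) ^ (1 / θ) := Real.rpow_pos_of_pos hr _
  refine map_eq_of_laplace_eq (hm r).aemeasurable
    (by filter_upwards [hS.nonneg] with ω h using h r) ((hm 1).const_mul _).aemeasurable
    (by filter_upwards [hS.nonneg] with ω h using mul_nonneg hr'.le (h 1)) fun l hl => ?_
  have h1 := hS.integral_exp hK 1 (mul_pos hl hr')
  simp only [mul_assoc] at h1
  rw [hS.integral_exp hK r hl, h1, Real.mul_rpow hl.le hr'.le,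
    ← Real.rpow_mul (NNReal.coe_nonneg r), one_div_mul_cancel hθ0.ne']
  simp [mul_comm]

/-- `E(t)` is distributed as `(t / S(1))^θ`. -/
lemma IsSubordinator.map_inverseProcess_eq [IsProbabilityMeasure P]
    (hS : IsSubordinator P S σ) (hθ0 : 0 < θ) (hθ1 : θ < 1)
    (hK : ∀ l : ℝ, 0 < l → kernelLaplace σ l = l ^ (θ - 1)) {t : ℝ} (ht : 0 < t) :
    P.map (inverseProcess S t) = P.map (fun ω => (t / S 1 ω) ^ θ) := by
  have hm := hS.measurable
  have hpos := hS.ae_one_pos hθ0 hθ1 hK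
  have hm1 : Measurable (fun ω => (t / S 1 ω) ^ θ) := by fun_prop
  have := hS.isProbabilityMeasure_map hK t
  refine Measure.ext_of_Iic _ _ fun a => ?_
  rw [Measure.map_apply hm1 measurableSet_Iic]
  rcases le_or_gt a 0 with ha | ha
  · have h1 : P.map (inverseProcess S t) (Iic a) = 0 := by
      have h := hS.ae_map_pos hK ht
      rw [ae_iff] at h
      refine measure_mono_null (fun τ hτ => ?_) h
      simpa using le_trans hτ ha
    rw [h1, eq_comm, ← nonpos_iff_eq_zero, ← (ae_iff.1 hpos)]
    refine measure_mono fun ω hω h => ?_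
    have : 0 < (t / S 1 ω) ^ θ := Real.rpow_pos_of_pos (div_pos ht h) _
    exact absurd (hω.trans ha) (not_le.2 this)
  · lift a to ℝ≥0 using ha.le
    have ha' : 0 < (a : ℝ) ^ (1 / θ) := Real.rpow_pos_of_pos ha _
    have h1 : P {ω | t ≤ S a ω} = P {ω | t ≤ (a : ℝ) ^ (1 / θ) * S 1 ω} := by
      have h := congrArg (fun μ => μ (Ici t)) (hS.map_eq_scaled hθ0 hK (r := a) ha)
      rwa [Measure.map_apply (hm a) measurableSet_Ici,
        Measure.map_apply ((hm 1).const_mul _) measurableSet_Ici] at h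
    rw [hS.map_inverseProcess_Iic hK, h1]
    refine measure_congr ?_
    filter_upwards [hpos] with ω hω
    refine propext ?_
    change t ≤ (a : ℝ) ^ (1 / θ) * S 1 ω ↔ (t / S 1 ω) ^ θ ≤ a
    rw [← div_le_iff₀ hω, one_div, 
      Real.le_rpow_inv_iff_of_pos (by positivity) (NNReal.coe_nonneg a) hθ0]

/-- The law of `E(t)` has a density: it is the image of the law of `S(1)` under the diffeomorphism
`s ↦ (t / s)^θ` of `(0, ∞)`. -/
theorem IsSubordinator.map_inverseProcess_absolutelyContinuous [IsProbabilityMeasure P]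
    (hS : IsSubordinator P S σ) (hθ0 : 0 < θ) (hθ1 : θ < 1)
    (hK : ∀ l : ℝ, 0 < l → kernelLaplace σ l = l ^ (θ - 1)) {t : ℝ} (ht : 0 < t) :
    P.map (inverseProcess S t) ≪ volume := by
  have hm := hS.measurable
  have hm1 : Measurable (fun ω => (t / S 1 ω) ^ θ) := by fun_prop
  refine Measure.AbsolutelyContinuous.mk fun s hs hs0 => ?_
  rw [hS.map_inverseProcess_eq hθ0 hθ1 hK ht, Measure.map_apply hm1 hs]
  have hnull : volume ((fun y : ℝ => t / y ^ (1 / θ)) '' (s ∩ Ioi 0)) = 0 := by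
    refine addHaar_image_eq_zero_of_differentiableOn_of_addHaar_eq_zero volume ?_
      (measure_mono_null inter_subset_left hs0)
    intro y hy
    have hy0 : (0 : ℝ) < y := hy.2
    refine DifferentiableAt.differentiableWithinAt ?_
    exact (differentiableAt_const t).div
      (differentiableAt_id.rpow_const (Or.inl hy0.ne')) (Real.rpow_pos_of_pos hy0 _).ne'
  have h2 := hS.map_one_absolutelyContinuous hθ0 hθ1 hK hnull
  have h3 := ae_of_ae_map (hm 1).aemeasurable (compl_mem_ae_iff.2 h2)
  refine measure_mono_null (t := {ω | ¬ (0 < S 1 ω ∧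
    S 1 ω ∉ (fun y : ℝ => t / y ^ (1 / θ)) '' (s ∩ Ioi 0))}) (fun ω hω => ?_)
    (ae_iff.1 ((hS.ae_one_pos hθ0 hθ1 hK).and h3))
  rintro ⟨h0, h⟩
  have h4 : 0 < t / S 1 ω := div_pos ht h0
  refine h ⟨(t / S 1 ω) ^ θ, ⟨hω, Real.rpow_pos_of_pos h4 _⟩, ?_⟩
  simp only
  rw [← Real.rpow_mul h4.le, mul_one_div_cancel hθ0.ne', Real.rpow_one]
  field_simp

end InverseDensity

/-! ### Karamata's Tauberian theorem -/

/-- The method of moments on `[0, 1]`: by Weierstrass approximation, convergence of moments gives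
weak convergence. -/
lemma tendsto_integral_of_tendsto_moments {ι : Type*} {L : Filter ι} {μ : ι → Measure ℝ}
    {ν : Measure ℝ} [IsProbabilityMeasure ν]
    (hμ : ∀ᶠ i in L, IsProbabilityMeasure (μ i) ∧ ∀ᵐ y ∂μ i, y ∈ Icc (0 : ℝ) 1)
    (hν : ∀ᵐ y ∂ν, y ∈ Icc (0 : ℝ) 1)
    (hmom : ∀ n : ℕ, Tendsto (fun i => ∫ y, y ^ n ∂μ i) L (𝓝 (∫ y, y ^ n ∂ν)))
    {g : ℝ → ℝ} (hg : Continuous g) :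
    Tendsto (fun i => ∫ y, g y ∂μ i) L (𝓝 (∫ y, g y ∂ν)) := by
  have hint : ∀ (m : Measure ℝ), IsProbabilityMeasure m → (∀ᵐ y ∂m, y ∈ Icc (0 : ℝ) 1) →
      ∀ h : ℝ → ℝ, Continuous h → Integrable h m := by
    intro m _ hm h hh
    obtain ⟨C, hC⟩ := (isCompact_Icc (a := (0 : ℝ)) (b := 1)).exists_bound_of_continuousOn
      hh.continuousOn
    exact Integrable.of_bound hh.aestronglyMeasurable C
      (by filter_upwards [hm] with y hy using hC y hy)
  have hpoly : ∀ p : Polynomial ℝ,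
      Tendsto (fun i => ∫ y, p.eval y ∂μ i) L (𝓝 (∫ y, p.eval y ∂ν)) := by
    intro p
    have hsum : ∀ (m : Measure ℝ), IsProbabilityMeasure m → (∀ᵐ y ∂m, y ∈ Icc (0 : ℝ) 1) →
        ∫ y, p.eval y ∂m = ∑ k ∈ Finset.range (p.natDegree + 1), p.coeff k * ∫ y, y ^ k ∂m := by
      intro m hm hm1
      simp_rw [Polynomial.eval_eq_sum_range]
      rw [integral_finsetSum _ fun k _ => hint m hm hm1 _ (by fun_prop)]
      simp_rw [integral_const_mul]
    rw [hsum ν inferInstance hν]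
    refine Tendsto.congr' ?_ (tendsto_finsetSum _ fun k _ => (hmom k).const_mul (p.coeff k))
    filter_upwards [hμ] with i hi
    exact (hsum (μ i) hi.1 hi.2).symm
  rw [Metric.tendsto_nhds]
  intro ε hε
  obtain ⟨p, hp⟩ := exists_polynomial_near_of_continuousOn 0 1 g hg.continuousOn (ε / 3)
    (by positivity)
  have hclose : ∀ (m : Measure ℝ), IsProbabilityMeasure m → (∀ᵐ y ∂m, y ∈ Icc (0 : ℝ) 1) →
      |∫ y, p.eval y ∂m - ∫ y, g y ∂m| ≤ ε / 3 := by
    intro m hm hm1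
    rw [← integral_sub (hint m hm hm1 _ p.continuous) (hint m hm hm1 _ hg)]
    have := norm_integral_le_of_norm_le_const (μ := m) (C := ε / 3)
      (f := fun y => p.eval y - g y) (by filter_upwards [hm1] with y hy using (hp y hy).le)
    simpa using this
  filter_upwards [hμ, Metric.tendsto_nhds.1 (hpoly p) (ε / 3) (by positivity)] with i hi h
  have h1 := abs_le.1 (hclose (μ i) hi.1 hi.2)
  have h2 := abs_le.1 (hclose ν inferInstance hν)
  rw [Real.dist_eq, abs_lt] at h ⊢
  constructor <;> linarith [h1.1, h1.2, h2.1, h2.2, h.1, h.2]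

/-- The continuous ramp from `0` at `a` to `1` at `a + δ`. -/
noncomputable def ramp (a δ y : ℝ) : ℝ := max 0 (min 1 ((y - a) / δ))

lemma continuous_ramp (a δ : ℝ) : Continuous (ramp a δ) := by
  unfold ramp
  fun_prop

lemma ramp_nonneg (a δ y : ℝ) : 0 ≤ ramp a δ y := le_max_left _ _

lemma ramp_le_one (a δ y : ℝ) : ramp a δ y ≤ 1 := max_le zero_le_one (min_le_left _ _)

lemma ramp_eq_zero {a δ y : ℝ} (hδ : 0 < δ) (h : y ≤ a) : ramp a δ y = 0 :=
  max_eq_left ((min_le_right _ _).trans (div_nonpos_of_nonpos_of_nonneg (by linarith) hδ.le))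

lemma ramp_eq_one {a δ y : ℝ} (hδ : 0 < δ) (h : a + δ ≤ y) : ramp a δ y = 1 := by
  have : 1 ≤ (y - a) / δ := by rw [one_le_div hδ]; linarith
  simp [ramp, min_eq_left this]

/-- Weak convergence tested on a continuous function cut off at a point that is not an atom of the
limit. -/
lemma tendsto_setIntegral_Ici_of_tendsto_integral {ι : Type*} {L : Filter ι} {μ : ι → Measure ℝ}
    {ν : Measure ℝ} [IsFiniteMeasure ν] (hμ : ∀ᶠ i in L, IsFiniteMeasure (μ i))
    (h : ∀ g : ℝ → ℝ, Continuous g → Tendsto (fun i => ∫ y, g y ∂μ i) L (𝓝 (∫ y, g y ∂ν)))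
    {φ : ℝ → ℝ} (hφ : Continuous φ) (hφ0 : ∀ y, 0 ≤ φ y) {C : ℝ} (hφC : ∀ y, φ y ≤ C) {c : ℝ}
    (hc : ν {c} = 0) :
    Tendsto (fun i => ∫ y in Ici c, φ y ∂μ i) L (𝓝 (∫ y in Ici c, φ y ∂ν)) := by
  have hint : ∀ (m : Measure ℝ), IsFiniteMeasure m → ∀ a δ : ℝ,
      Integrable (fun y => φ y * ramp a δ y) m := by
    intro m _ a δ
    refine Integrable.of_bound (hφ.mul (continuous_ramp a δ)).aestronglyMeasurable C
      (Eventually.of_forall fun y => ?_)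
    rw [Real.norm_of_nonneg (mul_nonneg (hφ0 y) (ramp_nonneg _ _ _))]
    exact (mul_le_of_le_one_right (hφ0 y) (ramp_le_one _ _ _)).trans (hφC y)
  have hintφ : ∀ (m : Measure ℝ), IsFiniteMeasure m → Integrable ((Ici c).indicator φ) m := by
    intro m _
    refine Integrable.indicator (Integrable.of_bound hφ.aestronglyMeasurable C
      (Eventually.of_forall fun y => ?_)) measurableSet_Ici
    rw [Real.norm_of_nonneg (hφ0 y)]
    exact hφC y
  have hlow : ∀ (m : Measure ℝ), IsFiniteMeasure m → ∀ δ : ℝ, 0 < δ →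
      ∫ y, φ y * ramp c δ y ∂m ≤ ∫ y in Ici c, φ y ∂m := by
    intro m hm δ hδ
    rw [← integral_indicator measurableSet_Ici]
    refine integral_mono (hint m hm c δ) (hintφ m hm) fun y => ?_
    by_cases hy : y ∈ Ici c
    · rw [indicator_of_mem hy]
      exact mul_le_of_le_one_right (hφ0 y) (ramp_le_one _ _ _)
    · rw [indicator_of_notMem hy]
      simp [ramp_eq_zero hδ (not_le.1 hy).le]
  have hupp : ∀ (m : Measure ℝ), IsFiniteMeasure m → ∀ δ : ℝ, 0 < δ →
      ∫ y in Ici c, φ y ∂m ≤ ∫ y, φ y * ramp (c - δ) δ y ∂m := by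
    intro m hm δ hδ
    rw [← integral_indicator measurableSet_Ici]
    refine integral_mono (hintφ m hm) (hint m hm (c - δ) δ) fun y => ?_
    by_cases hy : y ∈ Ici c
    · have : c - δ + δ ≤ y := by simpa using hy
      rw [indicator_of_mem hy, ramp_eq_one hδ this, mul_one]
    · rw [indicator_of_notMem hy]
      exact mul_nonneg (hφ0 y) (ramp_nonneg _ _ _)
  have hδ0 : Tendsto (fun k : ℕ => 1 / ((k : ℝ) + 1)) atTop (𝓝 0) :=
    tendsto_one_div_add_atTop_nhds_zero_nat
  have hδpos : ∀ k : ℕ, 0 < 1 / ((k : ℝ) + 1) := fun k => by positivity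
  have hne : ∀ᵐ y ∂ν, y ≠ c := by
    rw [ae_iff]
    simpa using hc
  have hlim : ∀ a : ℕ → ℝ, (∀ k, a k = c ∨ a k = c - 1 / ((k : ℝ) + 1)) →
      Tendsto (fun k : ℕ => ∫ y, φ y * ramp (a k) (1 / ((k : ℝ) + 1)) y ∂ν) atTop
        (𝓝 (∫ y in Ici c, φ y ∂ν)) := by
    intro a ha
    rw [← integral_indicator measurableSet_Ici]
    refine tendsto_integral_of_dominated_convergence (fun _ => C)
      (fun k => (hint ν inferInstance _ _).aestronglyMeasurable) (integrable_const C) ?_ ?_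
    · intro k
      refine Eventually.of_forall fun y => ?_
      rw [Real.norm_of_nonneg (mul_nonneg (hφ0 y) (ramp_nonneg _ _ _))]
      exact (mul_le_of_le_one_right (hφ0 y) (ramp_le_one _ _ _)).trans (hφC y)
    · filter_upwards [hne] with y hy
      refine tendsto_const_nhds.congr' ?_
      rcases lt_or_gt_of_ne hy with hlt | hgt
      · filter_upwards [hδ0.eventually (gt_mem_nhds (sub_pos.2 hlt))] with k hk
        have : y ≤ a k := by rcases ha k with h | h <;> rw [h] <;> linarith
        rw [indicator_of_notMem (by simpa using hlt), ramp_eq_zero (hδpos k) this, mul_zero]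
      · filter_upwards [hδ0.eventually (gt_mem_nhds (sub_pos.2 hgt))] with k hk
        have : a k + 1 / ((k : ℝ) + 1) ≤ y := by rcases ha k with h | h <;> rw [h] <;> linarith
        rw [indicator_of_mem (by simpa using hgt.le), ramp_eq_one (hδpos k) this, mul_one]
  rw [tendsto_order]
  constructor
  · intro b hb
    obtain ⟨k, hk⟩ := ((hlim (fun _ => c) fun _ => Or.inl rfl).eventually (lt_mem_nhds hb)).exists
    filter_upwards [hμ, (h _ (hφ.mul (continuous_ramp _ _))).eventually (lt_mem_nhds hk)]
      with i hi hi'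
    exact hi'.trans_le (hlow _ hi _ (hδpos k))
  · intro b hb
    obtain ⟨k, hk⟩ := ((hlim (fun k => c - 1 / ((k : ℝ) + 1)) fun _ => Or.inr rfl).eventually
      (gt_mem_nhds hb)).exists
    filter_upwards [hμ, (h _ (hφ.mul (continuous_ramp _ _))).eventually (gt_mem_nhds hk)]
      with i hi hi'
    exact (hupp _ hi _ (hδpos k)).trans_lt hi'

lemma integral_gammaMeasure {a : ℝ} (ha : 0 < a) (F : ℝ → ℝ) :
    ∫ u, F u ∂gammaMeasure a 1 =
      ∫ u in Ioi 0, (1 / Real.Gamma a * u ^ (a - 1) * Real.exp (-u)) * F u := by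
  rw [gammaMeasure, integral_withDensity_eq_integral_toReal_smul (f := gammaPDF a 1)
    (measurable_gammaPDFReal a 1).ennreal_ofReal (by simp [gammaPDF]),
    ← integral_Ici_eq_integral_Ioi, ← integral_indicator measurableSet_Ici]
  refine integral_congr_ae (Eventually.of_forall fun u => ?_)
  have hG := Real.Gamma_pos_of_pos ha
  by_cases hu : 0 ≤ u
  · have : 0 ≤ u ^ (a - 1) := Real.rpow_nonneg hu _
    simp only [gammaPDF, gammaPDFReal, hu, if_true, smul_eq_mul, indicator_of_mem (mem_Ici.2 hu)]
    rw [ENNReal.toReal_ofReal (by positivity)]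
    simp
  · simp [gammaPDF, gammaPDFReal, hu, indicator_of_notMem]

/-- Karamata's Tauberian theorem: if the Laplace transform `Λ` of a measure on `[0, ∞)` is regularly
varying at `0` of index `-ρ`, then the distribution function satisfies
`U([0, 1/l]) ~ Λ(l) / Γ(ρ + 1)` as `l → 0`. Regular variation is only needed along integer
dilations, since these give the moments of the tilted and rescaled measures on `[0, 1]`. -/
theorem karamata_tauberian {U : Measure ℝ} (hU : ∀ᵐ s ∂U, 0 ≤ s) {ρ : ℝ} (hρ : 0 < ρ)
    {Λ : ℝ → ℝ} (hΛ : ∀ l, 0 < l → ∫ s, Real.exp (-(l * s)) ∂U = Λ l)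
    (hpos : ∀ l, 0 < l → 0 < Λ l)
    (hreg : ∀ n : ℕ,
      Tendsto (fun l => Λ ((n + 1) * l) / Λ l) (𝓝[>] 0) (𝓝 (((n : ℝ) + 1) ^ (-ρ)))) :
    Tendsto (fun l => U.real (Iic (1 / l)) / Λ l) (𝓝[>] 0) (𝓝 (1 / Real.Gamma (ρ + 1))) := by
  have hint : ∀ l, 0 < l → Integrable (fun s => Real.exp (-(l * s))) U := by
    intro l hl
    by_contra h
    have h1 := hΛ l hl
    rw [integral_undef h] at h1
    exact (hpos l hl).ne h1
  -- the probability measures `e^{-ls} dU(s) / Λ(l)`, transported to `[0, 1]` by `s ↦ e^{-ls}`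
  set μ : ℝ → Measure ℝ := fun l => (U.withDensity fun s =>
    ENNReal.ofReal (Real.exp (-(l * s)) / Λ l)).map (fun s => Real.exp (-(l * s))) with hμdef
  set ν : Measure ℝ := (gammaMeasure ρ 1).map (fun u => Real.exp (-u)) with hνdef
  have hμint : ∀ l, 0 < l → ∀ F : ℝ → ℝ, Measurable F → ∫ y, F y ∂μ l =
      (∫ s, Real.exp (-(l * s)) * F (Real.exp (-(l * s))) ∂U) / Λ l := by
    intro l hl F hF
    rw [hμdef]
    simp only
    rw [integral_map (by fun_prop) hF.aestronglyMeasurable,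
      integral_withDensity_eq_integral_toReal_smul (by fun_prop) (by simp), ← integral_div]
    refine integral_congr_ae (Eventually.of_forall fun s => ?_)
    simp only [smul_eq_mul]
    rw [ENNReal.toReal_ofReal (div_nonneg (Real.exp_nonneg _) (hpos l hl).le)]
    ring
  have hνint : ∀ F : ℝ → ℝ, Measurable F → ∫ y, F y ∂ν =
      ∫ u in Ioi 0, (1 / Real.Gamma ρ * u ^ (ρ - 1) * Real.exp (-u)) * F (Real.exp (-u)) := by
    intro F hF
    rw [hνdef, integral_map (by fun_prop) hF.aestronglyMeasurable, integral_gammaMeasure hρ]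
  have : IsProbabilityMeasure (gammaMeasure ρ 1) := isProbabilityMeasure_gammaMeasure hρ one_pos
  have hνprob : IsProbabilityMeasure ν := Measure.isProbabilityMeasure_map (by fun_prop)
  have hμprob : ∀ l, 0 < l → IsProbabilityMeasure (μ l) := by
    intro l hl
    have : IsProbabilityMeasure (U.withDensity fun s =>
        ENNReal.ofReal (Real.exp (-(l * s)) / Λ l)) := by
      constructor
      rw [withDensity_apply _ MeasurableSet.univ, Measure.restrict_univ,
        ← ofReal_integral_eq_lintegral_ofReal ((hint l hl).div_const _)
          (Eventually.of_forall fun s => div_nonneg (Real.exp_nonneg _) (hpos l hl).le),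
        integral_div, hΛ l hl, div_self (hpos l hl).ne', ENNReal.ofReal_one]
    exact Measure.isProbabilityMeasure_map (by fun_prop)
  have hμIcc : ∀ l, 0 < l → ∀ᵐ y ∂μ l, y ∈ Icc (0 : ℝ) 1 := by
    intro l hl
    rw [hμdef]
    simp only
    rw [ae_map_iff (p := fun y => y ∈ Icc (0 : ℝ) 1) (by fun_prop) measurableSet_Icc]
    refine (withDensity_absolutelyContinuous U _).ae_le ?_
    filter_upwards [hU] with s hs
    exact ⟨Real.exp_nonneg _, Real.exp_le_one_iff.2 (by have := mul_nonneg hl.le hs; linarith)⟩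
  have hνIcc : ∀ᵐ y ∂ν, y ∈ Icc (0 : ℝ) 1 := by
    rw [hνdef, ae_map_iff (p := fun y => y ∈ Icc (0 : ℝ) 1) (by fun_prop) measurableSet_Icc,
      gammaMeasure, ae_withDensity_iff (f := gammaPDF ρ 1)
        (measurable_gammaPDFReal ρ 1).ennreal_ofReal]
    refine Eventually.of_forall fun u hu => ?_
    have : 0 ≤ u := by
      by_contra h
      exact hu (gammaPDF_of_neg (not_le.1 h))
    exact ⟨Real.exp_nonneg _, Real.exp_le_one_iff.2 (by linarith)⟩
  have hmom : ∀ n : ℕ, Tendsto (fun l => ∫ y, y ^ n ∂μ l) (𝓝[>] 0) (𝓝 (∫ y, y ^ n ∂ν)) := by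
    intro n
    have hn : (0 : ℝ) < n + 1 := by positivity
    have h1 : ∫ y, y ^ n ∂ν = ((n : ℝ) + 1) ^ (-ρ) := by
      rw [hνint _ (by fun_prop)]
      have h2 := Real.integral_rpow_mul_exp_neg_mul_Ioi hρ hn
      have hG := (Real.Gamma_pos_of_pos hρ).ne'
      calc _ = ∫ u in Ioi 0, 1 / Real.Gamma ρ * (u ^ (ρ - 1) * Real.exp (-((n + 1) * u))) := by
            refine integral_congr_ae (Eventually.of_forall fun u => ?_)
            simp only
            rw [← Real.exp_nat_mul, mul_assoc, mul_assoc, ← Real.exp_add]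
            congr 3
            ring
        _ = ((n : ℝ) + 1) ^ (-ρ) := by
            rw [integral_const_mul, h2, one_div ((n : ℝ) + 1), Real.inv_rpow hn.le,
              Real.rpow_neg hn.le]
            field_simp
    rw [h1]
    refine (hreg n).congr' ?_
    filter_upwards [self_mem_nhdsWithin] with l hl
    have hl : 0 < l := hl
    rw [hμint l hl _ (by fun_prop), ← hΛ _ (mul_pos hn hl)]
    congr 2
    ext s
    rw [← Real.exp_nat_mul, ← Real.exp_add]
    congr 1
    ring
  have hweak := fun (g : ℝ → ℝ) (hg : Continuous g) => tendsto_integral_of_tendsto_moments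
    (L := 𝓝[>] 0) (μ := μ) (ν := ν)
    (by filter_upwards [self_mem_nhdsWithin] with l hl using ⟨hμprob l hl, hμIcc l hl⟩)
    hνIcc hmom hg
  -- `1 / y` on `[1/e, 1]`, extended continuously: its integral recovers `U` on `[0, 1/l]`
  set c : ℝ := Real.exp (-1) with hc
  have hc0 : 0 < c := Real.exp_pos _
  have hmax : ∀ y, 0 < max y c := fun y => lt_max_of_lt_right hc0
  have hatom : ν {c} = 0 := by
    rw [hνdef, Measure.map_apply (by fun_prop) (measurableSet_singleton _)]
    have : (fun u => Real.exp (-u)) ⁻¹' {c} = {(1 : ℝ)} := by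
      ext u
      simp [hc]
    rw [this, gammaMeasure]
    exact withDensity_absolutelyContinuous _ _ Real.volume_singleton
  have hcut := tendsto_setIntegral_Ici_of_tendsto_integral (L := 𝓝[>] 0) (μ := μ) (ν := ν)
    (by filter_upwards [self_mem_nhdsWithin] with l hl
        have := hμprob l hl
        infer_instance) hweak (φ := fun y => 1 / max y c) (C := 1 / c)
    (Continuous.div continuous_const (by fun_prop) fun y => (hmax y).ne')
    (fun y => by have := hmax y; positivity)
    (fun y => one_div_le_one_div_of_le hc0 (le_max_right _ _)) hatom
  have hφm : Measurable fun y : ℝ => (Ici c).indicator (fun y => 1 / max y c) y :=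
    Measurable.indicator (by fun_prop) measurableSet_Ici
  have hexp : ∀ x : ℝ, Real.exp (-x) * (Ici c).indicator (fun y => 1 / max y c) (Real.exp (-x)) =
      (Iic 1).indicator (fun _ => 1) x := by
    intro x
    by_cases hx : x ≤ 1
    · have h1 : c ≤ Real.exp (-x) := Real.exp_le_exp.2 (by linarith)
      rw [indicator_of_mem (mem_Ici.2 h1), indicator_of_mem (mem_Iic.2 hx), max_eq_left h1,
        mul_one_div_cancel (Real.exp_pos _).ne']
    · have h1 : ¬ c ≤ Real.exp (-x) := by
        rw [hc, Real.exp_le_exp]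
        intro h
        exact hx (by linarith)
      rw [indicator_of_notMem (by simpa using h1), indicator_of_notMem (by simpa using hx),
        mul_zero]
  have hlimval : ∫ y in Ici c, 1 / max y c ∂ν = 1 / Real.Gamma (ρ + 1) := by
    rw [← integral_indicator measurableSet_Ici, hνint _ hφm]
    calc _ = ∫ u in Ioi 0, (Iic 1).indicator (fun u => 1 / Real.Gamma ρ * u ^ (ρ - 1)) u := by
          refine integral_congr_ae (Eventually.of_forall fun u => ?_)
          simp only
          rw [mul_assoc, hexp u]
          by_cases hu : u ∈ Iic (1 : ℝ)
          · simp [indicator_of_mem hu]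
          · simp [indicator_of_notMem hu]
      _ = ∫ u in (0 : ℝ)..1, 1 / Real.Gamma ρ * u ^ (ρ - 1) := by
          rw [setIntegral_indicator measurableSet_Iic, Ioi_inter_Iic,
            intervalIntegral.integral_of_le zero_le_one]
      _ = 1 / Real.Gamma (ρ + 1) := by
          rw [intervalIntegral.integral_const_mul, integral_rpow (Or.inl (by linarith)),
            Real.Gamma_add_one hρ.ne']
          have hG := (Real.Gamma_pos_of_pos hρ).ne'
          simp [hρ.ne']
  rw [hlimval] at hcut
  refine hcut.congr' ?_
  filter_upwards [self_mem_nhdsWithin] with l hl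
  have hl : 0 < l := hl
  rw [← integral_indicator measurableSet_Ici, hμint l hl _ hφm]
  congr 1
  simp_rw [hexp]
  rw [← integral_indicator_one measurableSet_Iic]
  refine integral_congr_ae (Eventually.of_forall fun s => ?_)
  have : s ≤ 1 / l ↔ l * s ≤ 1 := by rw [le_div_iff₀ hl, mul_comm]
  simp only
  by_cases hs : s ≤ 1 / l
  · rw [indicator_of_mem (mem_Iic.2 (this.1 hs)), indicator_of_mem (mem_Iic.2 hs), Pi.one_apply]
  · rw [indicator_of_notMem (s := Iic (1 : ℝ)) fun h => hs (this.2 h),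
      indicator_of_notMem (s := Iic (1 / l)) hs]

/-! ### The Laplace transform of the heat kernel and the Bessel function -/

section HeatKernel

variable {d : ℕ} {x : EuclideanSpace ℝ (Fin d)}

/-- The Laplace transform in time of the heat kernel. -/
noncomputable def heatLaplace {d : ℕ} (x : EuclideanSpace ℝ (Fin d)) (u : ℝ) : ℝ :=
  ∫ τ in Ioi 0, Real.exp (-(u * τ)) * heatKernel x τ

lemma heatKernel_pos (x : EuclideanSpace ℝ (Fin d)) {τ : ℝ} (hτ : 0 < τ) : 0 < heatKernel x τ := by
  have := Real.pi_pos
  unfold heatKernel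
  positivity

lemma measurable_heatKernel (x : EuclideanSpace ℝ (Fin d)) : Measurable (heatKernel x) := by
  unfold heatKernel
  fun_prop

/-- `v(x, τ) ≤ (2πτ)^{-d/2}`, the value at the origin. -/
lemma heatKernel_le_rpow (x : EuclideanSpace ℝ (Fin d)) {τ : ℝ} (hτ : 0 < τ) :
    heatKernel x τ ≤ (2 * Real.pi) ^ (-((d : ℝ) / 2)) * τ ^ (-((d : ℝ) / 2)) := by
  have hpi := Real.pi_pos
  have h1 : Real.exp (-(‖x‖ ^ 2 / (2 * τ))) ≤ 1 := Real.exp_le_one_iff.2 (by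
    have : 0 ≤ ‖x‖ ^ 2 / (2 * τ) := by positivity
    linarith)
  rw [← Real.mul_rpow (by positivity) hτ.le, Real.rpow_neg (by positivity), heatKernel, one_div]
  exact mul_le_of_le_one_right (by positivity) h1

/-- Off the diagonal the heat kernel is bounded in time: with `y = ‖x‖² / τ`,
`v² = (2πτ)^{-d} e^{-y}` and `y^d / d! ≤ e^y`. -/
lemma exists_heatKernel_le (hx : x ≠ 0) : ∃ C, ∀ τ, 0 < τ → heatKernel x τ ≤ C := by
  have hpi := Real.pi_pos
  have hx0 : 0 < ‖x‖ := norm_pos_iff.2 hx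
  refine ⟨Real.sqrt (d.factorial / (2 * Real.pi * ‖x‖ ^ 2) ^ d), fun τ hτ => ?_⟩
  refine Real.le_sqrt_of_sq_le ?_
  have hy : 0 < ‖x‖ ^ 2 / τ := by positivity
  have h1 := Real.pow_div_factorial_le_exp _ hy.le d
  have h2 : heatKernel x τ ^ 2 = 1 / (2 * Real.pi * τ) ^ d * (Real.exp (‖x‖ ^ 2 / τ))⁻¹ := by
    rw [heatKernel, mul_pow, div_pow, one_pow, ← Real.rpow_mul_natCast (by positivity),
      ← Real.exp_nat_mul, ← Real.exp_neg]
    congr 2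
    · rw [← Real.rpow_natCast]
      congr 2
      push_cast
      ring
    · push_cast
      field_simp
  have hf : (0 : ℝ) < d.factorial := by exact_mod_cast d.factorial_pos
  calc heatKernel x τ ^ 2
      = 1 / (2 * Real.pi * τ) ^ d * (Real.exp (‖x‖ ^ 2 / τ))⁻¹ := h2
    _ ≤ 1 / (2 * Real.pi * τ) ^ d * ((‖x‖ ^ 2 / τ) ^ d / d.factorial)⁻¹ := by gcongr
    _ = d.factorial / (2 * Real.pi * ‖x‖ ^ 2) ^ d := by
        simp only [div_pow, mul_pow]
        field_simp

lemma integrableOn_exp_neg_mul {u : ℝ} (hu : 0 < u) :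
    IntegrableOn (fun τ => Real.exp (-(u * τ))) (Ioi 0) := by
  have := integrableOn_exp_mul_Ioi (neg_lt_zero.2 hu) 0
  simpa [neg_mul] using this

lemma integrableOn_rpow_mul_exp {a u : ℝ} (ha : 0 < a) (hu : 0 < u) :
    IntegrableOn (fun t : ℝ => t ^ (a - 1) * Real.exp (-(u * t))) (Ioi 0) := by
  by_contra h
  have h1 := Real.integral_rpow_mul_exp_neg_mul_Ioi ha hu
  rw [integral_undef h] at h1
  have : 0 < (1 / u) ^ a * Real.Gamma a :=
    mul_pos (Real.rpow_pos_of_pos (by positivity) _) (Real.Gamma_pos_of_pos ha)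
  linarith

/-- The Laplace integral of the heat kernel converges off the diagonal, and everywhere in dimension
one. -/
lemma integrableOn_exp_mul_heatKernel (hdx : d = 1 ∨ x ≠ 0) {u : ℝ} (hu : 0 < u) :
    IntegrableOn (fun τ => Real.exp (-(u * τ)) * heatKernel x τ) (Ioi 0) := by
  have hmeas : AEStronglyMeasurable (fun τ => Real.exp (-(u * τ)) * heatKernel x τ)
      (volume.restrict (Ioi 0)) := by
    have := measurable_heatKernel x
    fun_prop
  rcases hdx with rfl | hx
  · refine Integrable.mono' ((integrableOn_rpow_mul_exp (a := 1 / 2) (by norm_num) hu).const_mul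
      ((2 * Real.pi) ^ (-((1 : ℝ) / 2)))) hmeas ?_
    filter_upwards [ae_restrict_mem measurableSet_Ioi] with τ hτ
    have h1 := heatKernel_le_rpow x hτ
    rw [Real.norm_of_nonneg (mul_nonneg (Real.exp_nonneg _) (heatKernel_pos x hτ).le)]
    calc Real.exp (-(u * τ)) * heatKernel x τ ≤ Real.exp (-(u * τ)) *
          ((2 * Real.pi) ^ (-(((1 : ℕ) : ℝ) / 2)) * τ ^ (-(((1 : ℕ) : ℝ) / 2))) := by gcongr
      _ = _ := by norm_num; ring
  · obtain ⟨C, hC⟩ := exists_heatKernel_le hx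
    refine Integrable.mono' ((integrableOn_exp_neg_mul hu).mul_const C) hmeas ?_
    filter_upwards [ae_restrict_mem measurableSet_Ioi] with τ hτ
    rw [Real.norm_of_nonneg (mul_nonneg (Real.exp_nonneg _) (heatKernel_pos x hτ).le)]
    have := hC τ hτ
    gcongr

lemma setIntegral_Ioi_pos {f : ℝ → ℝ} (hf : IntegrableOn f (Ioi 0)) (hpos : ∀ t, 0 < t → 0 < f t) :
    0 < ∫ t in Ioi 0, f t := by
  refine (setIntegral_pos_iff_support_of_nonneg_ae ?_ hf).2 ?_
  · filter_upwards [ae_restrict_mem measurableSet_Ioi] with t ht using (hpos t ht).le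
  · have : Ioi (0 : ℝ) ⊆ Function.support f ∩ Ioi 0 := fun t ht => ⟨(hpos t ht).ne', ht⟩
    refine lt_of_lt_of_le ?_ (measure_mono this)
    simp

lemma heatLaplace_pos (hdx : d = 1 ∨ x ≠ 0) {u : ℝ} (hu : 0 < u) : 0 < heatLaplace x u :=
  setIntegral_Ioi_pos (integrableOn_exp_mul_heatKernel hdx hu) fun _ hτ =>
    mul_pos (Real.exp_pos _) (heatKernel_pos x hτ)

/-- In dimension one the transform is `~ (2u)^{-1/2}`, whatever `x` is: substitute `τ = s / u`. -/
lemma tendsto_heatLaplace_one (x : EuclideanSpace ℝ (Fin 1)) :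
    Tendsto (fun u => u ^ ((1 : ℝ) / 2) * heatLaplace x u) (𝓝[>] 0) (𝓝 (1 / Real.sqrt 2)) := by
  have hpi := Real.pi_pos
  have hlim : Tendsto (fun u => ∫ s in Ioi 0, (2 * Real.pi) ^ (-((1 : ℝ) / 2)) *
      (s ^ ((1 : ℝ) / 2 - 1) * Real.exp (-(1 * s))) * Real.exp (-(‖x‖ ^ 2 * u / (2 * s))))
      (𝓝[>] 0) (𝓝 (∫ s in Ioi 0, (2 * Real.pi) ^ (-((1 : ℝ) / 2)) *
      (s ^ ((1 : ℝ) / 2 - 1) * Real.exp (-(1 * s))))) := by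
    refine tendsto_integral_filter_of_dominated_convergence
      (fun s => (2 * Real.pi) ^ (-((1 : ℝ) / 2)) * (s ^ ((1 : ℝ) / 2 - 1) * Real.exp (-(1 * s))))
      (Eventually.of_forall fun u => by fun_prop) ?_
      ((integrableOn_rpow_mul_exp (by norm_num) one_pos).const_mul _) ?_
    · filter_upwards [self_mem_nhdsWithin] with u hu
      have hu : 0 < u := hu
      filter_upwards [ae_restrict_mem measurableSet_Ioi] with s hs
      have hs : 0 < s := hs
      rw [Real.norm_of_nonneg (by positivity)]
      refine mul_le_of_le_one_right (by positivity) (Real.exp_le_one_iff.2 ?_)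
      have : 0 ≤ ‖x‖ ^ 2 * u / (2 * s) := by positivity
      linarith
    · filter_upwards with s
      have : Tendsto (fun u : ℝ => (2 * Real.pi) ^ (-((1 : ℝ) / 2)) *
          (s ^ ((1 : ℝ) / 2 - 1) * Real.exp (-(1 * s))) * Real.exp (-(‖x‖ ^ 2 * u / (2 * s))))
          (𝓝 0) (𝓝 ((2 * Real.pi) ^ (-((1 : ℝ) / 2)) *
          (s ^ ((1 : ℝ) / 2 - 1) * Real.exp (-(1 * s))) * Real.exp (-(‖x‖ ^ 2 * 0 / (2 * s))))) :=
        Continuous.tendsto (by fun_prop) 0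
      simpa using this.mono_left nhdsWithin_le_nhds
  have hval : ∫ s in Ioi 0, (2 * Real.pi) ^ (-((1 : ℝ) / 2)) *
      (s ^ ((1 : ℝ) / 2 - 1) * Real.exp (-(1 * s))) = 1 / Real.sqrt 2 := by
    rw [integral_const_mul, Real.integral_rpow_mul_exp_neg_mul_Ioi (by norm_num) one_pos,
      Real.Gamma_one_half_eq, Real.rpow_neg (by positivity), ← Real.sqrt_eq_rpow,
      Real.sqrt_mul (by norm_num)]
    have := (Real.sqrt_pos.2 hpi).ne'
    simp
    field_simp
  rw [hval] at hlim
  refine hlim.congr' ?_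
  filter_upwards [self_mem_nhdsWithin] with u hu
  have hu : 0 < u := hu
  have hsub := integral_comp_mul_left_Ioi
    (fun τ => Real.exp (-(u * τ)) * heatKernel x τ) 0 (inv_pos.2 hu)
  rw [mul_zero, inv_inv, smul_eq_mul] at hsub
  have h1 : heatLaplace x u = u⁻¹ * (u * heatLaplace x u) := by field_simp
  rw [h1, heatLaplace, ← hsub, ← mul_assoc, ← integral_const_mul]
  refine setIntegral_congr_fun measurableSet_Ioi fun s hs => ?_
  have hs : 0 < s := hs
  have e1 : u * (u⁻¹ * s) = s := by field_simp
  have e2 : ‖x‖ ^ 2 / (2 * (u⁻¹ * s)) = ‖x‖ ^ 2 * u / (2 * s) := by field_simp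
  have e3 : u ^ ((1 : ℝ) / 2) * u⁻¹ * (1 / (2 * Real.pi * (u⁻¹ * s)) ^ ((1 : ℝ) / 2)) =
      (2 * Real.pi) ^ (-((1 : ℝ) / 2)) * s ^ ((1 : ℝ) / 2 - 1) := by
    rw [Real.mul_rpow (by positivity) (by positivity), Real.mul_rpow (by positivity) hs.le,
      Real.inv_rpow hu.le, Real.rpow_neg (by positivity)]
    have h2 : s ^ ((1 : ℝ) / 2 - 1) = (s ^ ((1 : ℝ) / 2))⁻¹ := by
      rw [← Real.rpow_neg hs.le]; norm_num
    have h3 : u ^ ((1 : ℝ) / 2) * u ^ ((1 : ℝ) / 2) = u := by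
      rw [← Real.rpow_add hu]; norm_num
    have h4 : 0 < u ^ ((1 : ℝ) / 2) := Real.rpow_pos_of_pos hu _
    have h5 : 0 < s ^ ((1 : ℝ) / 2) := Real.rpow_pos_of_pos hs _
    rw [h2]
    field_simp
    rw [sq, h3]
  simp only [heatKernel]
  rw [e1, e2, one_mul]
  push_cast
  calc _ = ((2 * Real.pi) ^ (-((1 : ℝ) / 2)) * s ^ ((1 : ℝ) / 2 - 1)) * Real.exp (-s) *
        Real.exp (-(‖x‖ ^ 2 * u / (2 * s))) := by ring
    _ = _ := by rw [← e3]; ring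

/-- In dimension at least three the heat kernel is integrable in time off the diagonal. -/
lemma integrableOn_heatKernel (hd : 3 ≤ d) (hx : x ≠ 0) : IntegrableOn (heatKernel x) (Ioi 0) := by
  have hmeas := (measurable_heatKernel x).aestronglyMeasurable (μ := volume)
  rw [← Ioc_union_Ioi_eq_Ioi (zero_le_one (α := ℝ))]
  refine IntegrableOn.union ?_ ?_
  · obtain ⟨C, hC⟩ := exists_heatKernel_le hx
    refine Measure.integrableOn_of_bounded (M := C) (by simp) hmeas ?_
    filter_upwards [ae_restrict_mem measurableSet_Ioc] with τ hτ
    rw [Real.norm_of_nonneg (heatKernel_pos x hτ.1).le]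
    exact hC τ hτ.1
  · have hd' : (3 : ℝ) ≤ d := by exact_mod_cast hd
    refine Integrable.mono' ((integrableOn_Ioi_rpow_of_lt (a := -((d : ℝ) / 2)) (by linarith)
      one_pos).const_mul ((2 * Real.pi) ^ (-((d : ℝ) / 2)))) hmeas.restrict ?_
    filter_upwards [ae_restrict_mem measurableSet_Ioi] with τ hτ
    have hτ0 : 0 < τ := one_pos.trans hτ
    rw [Real.norm_of_nonneg (heatKernel_pos x hτ0).le]
    exact heatKernel_le_rpow x hτ0

lemma tendsto_heatLaplace_of_three_le (hd : 3 ≤ d) (hx : x ≠ 0) :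
    Tendsto (heatLaplace x) (𝓝[>] 0) (𝓝 (∫ τ in Ioi 0, heatKernel x τ)) := by
  have hm := measurable_heatKernel x
  refine tendsto_integral_filter_of_dominated_convergence (heatKernel x)
    (Eventually.of_forall fun u => by fun_prop) ?_ (integrableOn_heatKernel hd hx) ?_
  · filter_upwards [self_mem_nhdsWithin] with u hu
    have hu : 0 < u := hu
    filter_upwards [ae_restrict_mem measurableSet_Ioi] with τ hτ
    have hτ : 0 < τ := hτ
    have h0 := heatKernel_pos x hτ
    rw [Real.norm_of_nonneg (by positivity)]
    refine mul_le_of_le_one_left h0.le (Real.exp_le_one_iff.2 ?_)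
    have := mul_pos hu hτ
    linarith
  · filter_upwards with τ
    have : Tendsto (fun u : ℝ => Real.exp (-(u * τ)) * heatKernel x τ) (𝓝 0)
        (𝓝 (Real.exp (-(0 * τ)) * heatKernel x τ)) := Continuous.tendsto (by fun_prop) 0
    simpa using this.mono_left nhdsWithin_le_nhds

/-- The time integral of the heat kernel at distance one from the origin, that is, the Newtonian
potential there. -/
noncomputable def newtonConst (d : ℕ) : ℝ :=
  ∫ s in Ioi (0 : ℝ), 1 / (2 * Real.pi * s) ^ ((d : ℝ) / 2) * Real.exp (-(1 / (2 * s)))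

lemma integral_heatKernel (hx : x ≠ 0) :
    ∫ τ in Ioi 0, heatKernel x τ = newtonConst d * ‖x‖ ^ (2 - (d : ℝ)) := by
  have hx0 : 0 < ‖x‖ := norm_pos_iff.2 hx
  have hpi := Real.pi_pos
  have hsub := integral_comp_mul_left_Ioi (heatKernel x) 0 (pow_pos hx0 2)
  rw [mul_zero, smul_eq_mul] at hsub
  have h1 : ∫ τ in Ioi 0, heatKernel x τ =
      ‖x‖ ^ 2 * ((‖x‖ ^ 2)⁻¹ * ∫ τ in Ioi 0, heatKernel x τ) := by
    field_simp
  rw [h1, ← hsub, newtonConst, ← integral_mul_const, ← integral_const_mul]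
  refine setIntegral_congr_fun measurableSet_Ioi fun s hs => ?_
  have hs : 0 < s := hs
  have e1 : ‖x‖ ^ 2 / (2 * (‖x‖ ^ 2 * s)) = 1 / (2 * s) := by field_simp
  have e2 : (2 * Real.pi * (‖x‖ ^ 2 * s)) ^ ((d : ℝ) / 2) =
      ‖x‖ ^ (d : ℝ) * (2 * Real.pi * s) ^ ((d : ℝ) / 2) := by
    rw [show 2 * Real.pi * (‖x‖ ^ 2 * s) = ‖x‖ ^ 2 * (2 * Real.pi * s) by ring,
      Real.mul_rpow (by positivity) (by positivity), ← Real.rpow_natCast_mul hx0.le]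
    congr 2
    push_cast
    ring
  simp only [heatKernel]
  rw [e1, e2, Real.rpow_sub hx0, Real.rpow_two]
  field_simp

lemma newtonConst_pos (hd : 3 ≤ d) : 0 < newtonConst d := by
  have : NeZero d := ⟨by omega⟩
  have hx : (EuclideanSpace.single (0 : Fin d) (1 : ℝ)) ≠ 0 := fun h => by
    have := congrArg norm h
    simp at this
  have h1 := setIntegral_Ioi_pos (integrableOn_heatKernel hd hx) fun _ hτ => heatKernel_pos _ hτ
  rw [integral_heatKernel hx] at h1
  simpa using h1

end HeatKernel

section Bessel

/-- The integral over the line `∫ e^{-aw} e^{-z cosh w} dw` is `2 K_a(z)`, by symmetrization. -/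
lemma integral_exp_mul_exp_cosh {a z : ℝ}
    (hint : Integrable fun w => Real.exp (-(a * w)) * Real.exp (-(z * Real.cosh w))) :
    ∫ w, Real.exp (-(a * w)) * Real.exp (-(z * Real.cosh w)) = 2 * besselK a z := by
  set G : ℝ → ℝ := fun w => Real.exp (-(a * w)) * Real.exp (-(z * Real.cosh w)) with hG
  have hneg : ∫ w, G (-w) = ∫ w, G w := integral_neg_eq_self G volume
  have habs := integral_comp_abs
    (f := fun w => Real.exp (-(z * Real.cosh w)) * Real.cosh (a * w))
  have hsym : ∀ w : ℝ, Real.exp (-(z * Real.cosh |w|)) * Real.cosh (a * |w|) =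
      (G w + G (-w)) / 2 := by
    intro w
    have h1 : Real.cosh (a * |w|) = Real.cosh (a * w) := by
      rcases abs_choice w with h | h <;> rw [h]
      rw [mul_neg, Real.cosh_neg]
    simp only [hG]
    rw [Real.cosh_abs, h1, Real.cosh_neg, Real.cosh_eq (a * w), mul_neg, neg_neg]
    ring
  simp only [hsym] at habs
  rw [integral_div, integral_add hint hint.comp_neg, hneg] at habs
  rw [besselK, ← habs]
  ring

/-- The substitution `τ = (‖x‖ / √(2u)) e^w` turns the Laplace transform of the heat kernel into a
Bessel function of order `d/2 - 1` at `√(2u) ‖x‖`. -/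
lemma heatLaplace_eq_besselK {d : ℕ} {x : EuclideanSpace ℝ (Fin d)} (hx : x ≠ 0) {u : ℝ}
    (hu : 0 < u) :
    heatLaplace x u = 2 * (2 * Real.pi) ^ (-((d : ℝ) / 2)) *
      (‖x‖ / (Real.sqrt 2 * Real.sqrt u)) ^ (1 - (d : ℝ) / 2) *
      besselK ((d : ℝ) / 2 - 1) (Real.sqrt 2 * ‖x‖ * Real.sqrt u) := by
  have hx0 : 0 < ‖x‖ := norm_pos_iff.2 hx
  have hpi := Real.pi_pos
  have h2 : 0 < Real.sqrt 2 := Real.sqrt_pos.2 (by norm_num)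
  have hsu : 0 < Real.sqrt u := Real.sqrt_pos.2 hu
  have h22 : Real.sqrt 2 * Real.sqrt 2 = 2 := Real.mul_self_sqrt (by norm_num)
  have huu : Real.sqrt u * Real.sqrt u = u := Real.mul_self_sqrt hu.le
  set z : ℝ := Real.sqrt 2 * ‖x‖ * Real.sqrt u with hz
  set β : ℝ := ‖x‖ / (Real.sqrt 2 * Real.sqrt u) with hβ
  have hβ0 : 0 < β := by positivity
  have hb1 : u * β = z / 2 := by
    rw [hβ, hz]
    field_simp
    nlinarith
  have hb2 : ‖x‖ ^ 2 / (2 * β) = z / 2 := by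
    rw [hβ, hz]
    field_simp
  set F : ℝ → ℝ := fun τ => Real.exp (-(u * τ)) * heatKernel x τ with hF
  have himg : (fun w : ℝ => β * Real.exp w) '' univ = Ioi 0 := by
    ext τ
    constructor
    · rintro ⟨w, -, rfl⟩
      exact mul_pos hβ0 (Real.exp_pos w)
    · intro hτ
      have hτ : 0 < τ := hτ
      refine ⟨Real.log (τ / β), mem_univ _, ?_⟩
      simp only
      rw [Real.exp_log (by positivity)]
      field_simp
  have hderiv : ∀ w ∈ (univ : Set ℝ), HasDerivWithinAt (fun w : ℝ => β * Real.exp w)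
      (β * Real.exp w) univ w := fun w _ => ((Real.hasDerivAt_exp w).const_mul β).hasDerivWithinAt
  have hinj : InjOn (fun w : ℝ => β * Real.exp w) univ := fun a _ b _ h =>
    Real.exp_injective (mul_left_cancel₀ hβ0.ne' h)
  have hval : ∀ w : ℝ, |β * Real.exp w| • F (β * Real.exp w) =
      ((2 * Real.pi) ^ (-((d : ℝ) / 2)) * β ^ (1 - (d : ℝ) / 2)) *
        (Real.exp (-(((d : ℝ) / 2 - 1) * w)) * Real.exp (-(z * Real.cosh w))) := by
    intro w
    have he := Real.exp_pos w
    have e1 : Real.exp (-(z * Real.cosh w)) = Real.exp (-(u * (β * Real.exp w))) *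
        Real.exp (-(‖x‖ ^ 2 / (2 * (β * Real.exp w)))) := by
      rw [← Real.exp_add, ← mul_assoc u, hb1, ← mul_assoc 2, ← div_div (‖x‖ ^ 2), hb2,
        Real.cosh_eq, Real.exp_neg w]
      congr 1
      field_simp
      ring
    have e2 : β * Real.exp w * (1 / (2 * Real.pi * (β * Real.exp w)) ^ ((d : ℝ) / 2)) =
        (2 * Real.pi) ^ (-((d : ℝ) / 2)) * β ^ (1 - (d : ℝ) / 2) *
          Real.exp (-(((d : ℝ) / 2 - 1) * w)) := by
      rw [Real.mul_rpow (by positivity) (by positivity), Real.mul_rpow hβ0.le he.le,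
        Real.rpow_neg (by positivity), Real.rpow_sub hβ0, Real.rpow_one, ← Real.exp_mul,
        show -(((d : ℝ) / 2 - 1) * w) = w - w * ((d : ℝ) / 2) by ring, Real.exp_sub]
      have := Real.rpow_pos_of_pos hβ0 ((d : ℝ) / 2)
      field_simp
    rw [abs_of_pos (by positivity), smul_eq_mul, hF]
    simp only [heatKernel]
    rw [← mul_assoc ((2 * Real.pi) ^ (-((d : ℝ) / 2)) * _), ← e2, e1]
    ring
  have hFint : IntegrableOn F (Ioi 0) := integrableOn_exp_mul_heatKernel (Or.inr hx) hu
  have hc : 0 < (2 * Real.pi) ^ (-((d : ℝ) / 2)) * β ^ (1 - (d : ℝ) / 2) := by positivity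
  have hGint : Integrable fun w =>
      Real.exp (-(((d : ℝ) / 2 - 1) * w)) * Real.exp (-(z * Real.cosh w)) := by
    rw [← himg, integrableOn_image_iff_integrableOn_abs_deriv_smul MeasurableSet.univ hderiv hinj,
      integrableOn_univ] at hFint
    simp only [hval] at hFint
    exact (integrable_const_mul_iff (isUnit_iff_ne_zero.2 hc.ne') _).1 hFint
  have hsub := integral_image_eq_integral_abs_deriv_smul MeasurableSet.univ hderiv hinj F
  rw [himg, setIntegral_univ] at hsub
  simp only [hval] at hsub
  rw [heatLaplace, hsub, integral_const_mul, integral_exp_mul_exp_cosh hGint]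
  ring

/-- With `L = -log z`, the integrand of `K_0(z)` is close to `1` up to `L` and decays
doubly exponentially beyond it. -/
lemma besselK_zero_bounds {z : ℝ} (hz : 0 < z) (hz1 : z < 1) :
    -Real.log z - 1 ≤ besselK 0 z ∧ besselK 0 z ≤ -Real.log z + 2 := by
  set L : ℝ := -Real.log z with hL
  have hL0 : 0 < L := neg_pos.2 (Real.log_neg hz hz1)
  have hzL : z * Real.exp L = 1 := by
    rw [hL, Real.exp_neg, Real.exp_log hz, mul_inv_cancel₀ hz.ne']
  have hcosh : ∀ w : ℝ, Real.exp w / 2 ≤ Real.cosh w := fun w => by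
    rw [Real.cosh_eq]
    have := Real.exp_pos (-w)
    linarith
  have htail : ∀ w : ℝ, Real.exp (-(z * Real.cosh w)) ≤
      Real.exp (L / 2) * Real.exp (-(1 / 2) * w) := by
    intro w
    rw [← Real.exp_add, Real.exp_le_exp]
    have h1 : w - L + 1 ≤ Real.exp (w - L) := Real.add_one_le_exp _
    have h2 : Real.exp (w - L) = z * Real.exp w := by
      rw [Real.exp_sub, div_eq_iff (Real.exp_pos L).ne', mul_right_comm, hzL, one_mul]
    have h3 := mul_le_mul_of_nonneg_left (hcosh w) hz.le
    linarith
  have hdom : ∀ a : ℝ, IntegrableOn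
      (fun w => Real.exp (L / 2) * Real.exp (-(1 / 2) * w)) (Ioi a) := fun a =>
    (integrableOn_exp_mul_Ioi (by norm_num) a).const_mul _
  have hint : ∀ a : ℝ, IntegrableOn (fun w => Real.exp (-(z * Real.cosh w))) (Ioi a) := fun a => by
    refine Integrable.mono' (hdom a) (by fun_prop) (Eventually.of_forall fun w => ?_)
    rw [Real.norm_of_nonneg (Real.exp_nonneg _)]
    exact htail w
  have hK : besselK 0 z = (∫ w in (0 : ℝ)..L, Real.exp (-(z * Real.cosh w))) +
      ∫ w in Ioi L, Real.exp (-(z * Real.cosh w)) := by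
    rw [intervalIntegral.integral_interval_add_Ioi (hint 0) (hint L), besselK]
    simp
  have hI : IntervalIntegrable (fun w => Real.exp (-(z * Real.cosh w))) volume 0 L :=
    Continuous.intervalIntegrable (by fun_prop) _ _
  rw [hK]
  constructor
  · have h1 : ∫ w in (0 : ℝ)..L, (1 - z * Real.exp w) ≤
        ∫ w in (0 : ℝ)..L, Real.exp (-(z * Real.cosh w)) := by
      refine intervalIntegral.integral_mono_on hL0.le
        (Continuous.intervalIntegrable (by fun_prop) _ _) hI fun w hw => ?_
      have h2 := Real.add_one_le_exp (-(z * Real.cosh w))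
      have h3 : Real.cosh w ≤ Real.exp w := by
        rw [Real.cosh_eq]
        have := Real.exp_le_exp.2 (show -w ≤ w by linarith [hw.1])
        linarith
      have h4 := mul_le_mul_of_nonneg_left h3 hz.le
      linarith
    have h2 : ∫ w in (0 : ℝ)..L, (1 - z * Real.exp w) = L - 1 + z := by
      rw [intervalIntegral.integral_sub intervalIntegrable_const
        (Continuous.intervalIntegrable (by fun_prop) _ _), intervalIntegral.integral_const_mul,
        integral_exp, intervalIntegral.integral_const, mul_sub, hzL]
      simp
      ring
    have h3 : 0 ≤ ∫ w in Ioi L, Real.exp (-(z * Real.cosh w)) :=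
      integral_nonneg fun _ => Real.exp_nonneg _
    linarith
  · have h1 : ∫ w in (0 : ℝ)..L, Real.exp (-(z * Real.cosh w)) ≤ ∫ w in (0 : ℝ)..L, (1 : ℝ) := by
      refine intervalIntegral.integral_mono_on hL0.le hI intervalIntegrable_const fun w _ => ?_
      rw [Real.exp_le_one_iff]
      have := mul_pos hz (Real.cosh_pos w)
      linarith
    have h2 : ∫ w in Ioi L, Real.exp (-(z * Real.cosh w)) ≤
        ∫ w in Ioi L, Real.exp (L / 2) * Real.exp (-(1 / 2) * w) :=
      integral_mono (hint L) (hdom L) htail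
    have h3 : ∫ w in Ioi L, Real.exp (L / 2) * Real.exp (-(1 / 2) * w) = 2 := by
      rw [integral_const_mul, integral_exp_mul_Ioi (by norm_num)]
      have : Real.exp (L / 2) * Real.exp (-(1 / 2) * L) = 1 := by
        rw [← Real.exp_add]
        simp
        ring
      linarith
    simp at h1
    linarith

lemma tendsto_neg_log_nhdsGT_zero : Tendsto (fun z => -Real.log z) (𝓝[>] 0) atTop :=
  tendsto_neg_atBot_atTop.comp Real.tendsto_log_nhdsGT_zero

lemma besselK_zero_isEquivalent :
    (besselK 0) ~[𝓝[>] 0] (fun z => -Real.log z) := by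
  refine IsLittleO.of_bound fun c hc => ?_
  have h1 : ∀ᶠ z : ℝ in 𝓝[>] 0, z < 1 := nhdsWithin_le_nhds (Iio_mem_nhds one_pos)
  filter_upwards [self_mem_nhdsWithin, h1,
    tendsto_neg_log_nhdsGT_zero.eventually_ge_atTop (2 / c)] with z hz hz1 hz2
  obtain ⟨h3, h4⟩ := besselK_zero_bounds hz hz1
  have h5 : 2 ≤ c * -Real.log z := by
    rw [div_le_iff₀ hc] at hz2
    linarith
  have h6 : 0 < -Real.log z := neg_pos.2 (Real.log_neg hz hz1)
  rw [Pi.sub_apply, Real.norm_eq_abs, Real.norm_of_nonneg h6.le]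
  refine abs_le.2 ⟨by linarith, by linarith⟩

lemma tendsto_const_mul_nhdsGT_zero {c : ℝ} (hc : 0 < c) :
    Tendsto (fun z : ℝ => c * z) (𝓝[>] 0) (𝓝[>] 0) := by
  refine tendsto_nhdsWithin_of_tendsto_nhds_of_eventually_within _ ?_ ?_
  · have : Tendsto (fun z : ℝ => c * z) (𝓝 0) (𝓝 (c * 0)) := Continuous.tendsto (by fun_prop) 0
    rw [mul_zero] at this
    exact this.mono_left nhdsWithin_le_nhds
  · filter_upwards [self_mem_nhdsWithin] with z hz using mul_pos hc hz

/-- Logarithmic growth makes `K_0` slowly varying at `0`. -/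
lemma tendsto_besselK_zero_ratio {a : ℝ} (ha : 0 < a) :
    Tendsto (fun z => besselK 0 (a * z) / besselK 0 z) (𝓝[>] 0) (𝓝 1) := by
  have h1 := (besselK_zero_isEquivalent.comp_tendsto (tendsto_const_mul_nhdsGT_zero ha)).div
    besselK_zero_isEquivalent
  have h2 : Tendsto (fun z => -Real.log (a * z) / -Real.log z) (𝓝[>] 0) (𝓝 1) := by
    have h3 : Tendsto (fun z => -Real.log a / -Real.log z + 1) (𝓝[>] 0) (𝓝 (0 + 1)) :=
      (tendsto_neg_log_nhdsGT_zero.const_div_atTop (-Real.log a)).add_const 1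
    rw [zero_add] at h3
    refine h3.congr' ?_
    have h4 : ∀ᶠ z : ℝ in 𝓝[>] 0, z < 1 := nhdsWithin_le_nhds (Iio_mem_nhds one_pos)
    filter_upwards [self_mem_nhdsWithin, h4] with z hz hz1
    have hz : 0 < z := hz
    have h5 := (Real.log_neg hz hz1).ne
    rw [Real.log_mul ha.ne' hz.ne']
    field_simp
  exact h1.symm.tendsto_nhds h2

end Bessel

/-! ### The subordinated heat kernel -/

section Subordinated

variable {Ω : Type*} [MeasurableSpace Ω] {P : Measure Ω} {S : ℝ≥0 → Ω → ℝ} {σ : Measure ℝ} {θ : ℝ}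
  {d : ℕ} {x : EuclideanSpace ℝ (Fin d)}

/-- The subordinated heat kernel as an expectation `𝔼[v(x, E(t))]` with values in `[0, ∞]`. -/
noncomputable def lsubordinatedKernel (P : Measure Ω) (S : ℝ≥0 → Ω → ℝ)
    (x : EuclideanSpace ℝ (Fin d)) (t : ℝ) : ℝ≥0∞ :=
  ∫⁻ τ, ENNReal.ofReal (heatKernel x τ) ∂P.map (inverseProcess S t)

lemma IsSubordinator.measurable_lsubordinatedKernel [IsProbabilityMeasure P]
    (hS : IsSubordinator P S σ)
    (hK : ∀ l : ℝ, 0 < l → kernelLaplace σ l = l ^ (θ - 1)) :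
    Measurable (lsubordinatedKernel P S x) :=
  (Measure.measurable_lintegral (measurable_heatKernel x).ennreal_ofReal).comp
    (hS.measurable_map hK)

lemma IsSubordinator.lintegral_exp_mul_lsubordinatedKernel [IsProbabilityMeasure P]
    (hS : IsSubordinator P S σ)
    (hK : ∀ l : ℝ, 0 < l → kernelLaplace σ l = l ^ (θ - 1)) (hdx : d = 1 ∨ x ≠ 0)
    {l : ℝ} (hl : 0 < l) :
    ∫⁻ t in Ioi 0, ENNReal.ofReal (Real.exp (-(l * t))) * lsubordinatedKernel P S x t =
      ENNReal.ofReal (l ^ (θ - 1) * heatLaplace x (l ^ θ)) := by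
  have hm := hS.measurable_map hK
  have hV := hS.measurable_lsubordinatedKernel hK (x := x)
  have hv := measurable_heatKernel x
  have hlθ : 0 < l ^ θ := Real.rpow_pos_of_pos hl θ
  have hl0 : ENNReal.ofReal l ≠ 0 := by simpa using hl
  have h := congrArg (fun m => ∫⁻ τ, ENNReal.ofReal (heatKernel x τ) ∂m)
    (hS.bind_map_inverseProcess hK hl)
  rw [Measure.lintegral_bind hm.aemeasurable hv.ennreal_ofReal.aemeasurable] at h
  change ∫⁻ t, lsubordinatedKernel P S x t ∂_ = _ at h
  rw [lintegral_withDensity_eq_lintegral_mul _ (by fun_prop) hV,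
    lintegral_withDensity_eq_lintegral_mul _ (by fun_prop) hv.ennreal_ofReal] at h
  have h1 : ∫⁻ t in Ioi 0, ENNReal.ofReal (l * Real.exp (-(l * t))) * lsubordinatedKernel P S x t =
      ENNReal.ofReal l * ∫⁻ t in Ioi 0, ENNReal.ofReal (Real.exp (-(l * t))) *
        lsubordinatedKernel P S x t := by
    rw [← lintegral_const_mul _ (by fun_prop)]
    refine lintegral_congr fun t => ?_
    rw [ENNReal.ofReal_mul hl.le, mul_assoc]
  have h2 : ∫⁻ τ in Ioi 0, ENNReal.ofReal (l ^ θ * Real.exp (-(l ^ θ * τ))) *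
      ENNReal.ofReal (heatKernel x τ) = ENNReal.ofReal (l ^ θ * heatLaplace x (l ^ θ)) := by
    rw [heatLaplace, ← integral_const_mul, ofReal_integral_eq_lintegral_ofReal
      ((integrableOn_exp_mul_heatKernel hdx hlθ).const_mul _)]
    · refine lintegral_congr fun τ => ?_
      rw [← ENNReal.ofReal_mul (by positivity), mul_assoc]
    · filter_upwards [ae_restrict_mem measurableSet_Ioi] with τ hτ
      have := heatKernel_pos x hτ
      positivity
  have h3 : ENNReal.ofReal l * ∫⁻ t in Ioi 0, ENNReal.ofReal (Real.exp (-(l * t))) *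
        lsubordinatedKernel P S x t =
      ENNReal.ofReal l * ENNReal.ofReal (l ^ (θ - 1) * heatLaplace x (l ^ θ)) := by
    rw [← h1, ← ENNReal.ofReal_mul hl.le, ← mul_assoc, Real.rpow_sub_one hl.ne',
      mul_div_cancel₀ _ hl.ne', ← h2]
    exact h
  exact (ENNReal.mul_right_inj hl0 ENNReal.ofReal_ne_top).1 h3

/-- `𝔼[v(x, E(t))]` is finite for every `t > 0`. Off the diagonal `v` is bounded in time. At the
origin of the line, finiteness for almost every `t` follows from the Laplace transform and
propagates to every `t` because the expectation decreases in `t`. -/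
lemma IsSubordinator.lsubordinatedKernel_lt_top [IsProbabilityMeasure P]
    (hS : IsSubordinator P S σ)
    (hK : ∀ l : ℝ, 0 < l → kernelLaplace σ l = l ^ (θ - 1)) (hdx : d = 1 ∨ x ≠ 0)
    {t : ℝ} (ht : 0 < t) : lsubordinatedKernel P S x t < ∞ := by
  have hprob := hS.isProbabilityMeasure_map hK t
  by_cases hx : x = 0
  · have hlap := hS.lintegral_exp_mul_lsubordinatedKernel hK hdx one_pos
    have hae := ae_lt_top (μ := volume.restrict (Ioi 0))
      (f := fun t => ENNReal.ofReal (Real.exp (-(1 * t))) * lsubordinatedKernel P S x t)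
      (by have := hS.measurable_lsubordinatedKernel hK (x := x); fun_prop)
      (by rw [hlap]; exact ENNReal.ofReal_ne_top)
    have hae' : ∀ᵐ s ∂volume.restrict (Ioo 0 t), lsubordinatedKernel P S x s < ∞ := by
      filter_upwards [ae_restrict_of_ae_restrict_of_subset Ioo_subset_Ioi_self hae] with s hs
      by_contra h
      rw [not_lt, top_le_iff] at h
      rw [h, ENNReal.mul_top (by simpa using Real.exp_pos _)] at hs
      exact lt_irrefl _ hs
    have hne : (ae (volume.restrict (Ioo 0 t))).NeBot := by
      rw [ae_neBot, Ne, Measure.restrict_eq_zero]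
      simpa using ht
    obtain ⟨s, hs, hs0⟩ := (hae'.and (ae_restrict_mem measurableSet_Ioo)).exists
    refine lt_of_le_of_lt ?_ hs
    refine hS.lintegral_map_antitone hK (measurable_heatKernel x).ennreal_ofReal ?_ hs0.1 hs0.2.le
    intro a ha b _ hab
    have ha : 0 < a := ha
    have hpi := Real.pi_pos
    refine ENNReal.ofReal_le_ofReal ?_
    simp only [heatKernel, hx, norm_zero]
    norm_num
    gcongr
  · obtain ⟨C, hC⟩ := exists_heatKernel_le hx
    calc lsubordinatedKernel P S x t
        ≤ ∫⁻ _, ENNReal.ofReal C ∂P.map (inverseProcess S t) := by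
          refine lintegral_mono_ae ?_
          filter_upwards [hS.ae_map_pos hK ht] with τ hτ
          exact ENNReal.ofReal_le_ofReal (hC τ hτ)
      _ < ∞ := by simp

lemma IsSubordinator.lintegral_heatKernel_mul_inverseDensity [IsProbabilityMeasure P]
    (hS : IsSubordinator P S σ) (hθ0 : 0 < θ) (hθ1 : θ < 1)
    (hK : ∀ l : ℝ, 0 < l → kernelLaplace σ l = l ^ (θ - 1))
    {t : ℝ} (ht : 0 < t) :
    ∫⁻ τ in Ioi 0, ENNReal.ofReal (heatKernel x τ * inverseDensity P S t τ) =
      lsubordinatedKernel P S x t := by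
  have hprob := hS.isProbabilityMeasure_map hK t
  have hac := hS.map_inverseProcess_absolutelyContinuous hθ0 hθ1 hK ht
  have hv := (measurable_heatKernel x).ennreal_ofReal
  have hpos : (P.map (inverseProcess S t)).restrict (Ioi 0) = P.map (inverseProcess S t) :=
    Measure.restrict_eq_self_of_ae_mem (hS.ae_map_pos hK ht)
  rw [lsubordinatedKernel, ← hpos, ← setLIntegral_rnDeriv_mul hac hv.aemeasurable measurableSet_Ioi]
  refine lintegral_congr_ae ?_
  filter_upwards [ae_restrict_mem measurableSet_Ioi,
    ae_restrict_of_ae (Measure.rnDeriv_lt_top (P.map (inverseProcess S t)) volume)] with τ hτ hfin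
  rw [ENNReal.ofReal_mul (heatKernel_pos x hτ).le, inverseDensity, ENNReal.ofReal_toReal hfin.ne,
    mul_comm]

lemma measurable_inverseDensity (t : ℝ) : Measurable (inverseDensity P S t) :=
  (Measure.measurable_rnDeriv _ _).ennreal_toReal

lemma ae_nonneg_heatKernel_mul_inverseDensity (t : ℝ) :
    0 ≤ᵐ[volume.restrict (Ioi 0)] fun τ => heatKernel x τ * inverseDensity P S t τ := by
  filter_upwards [ae_restrict_mem measurableSet_Ioi] with τ hτ
  exact mul_nonneg (heatKernel_pos x hτ).le ENNReal.toReal_nonneg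

lemma IsSubordinator.integrableOn_heatKernel_mul_inverseDensity [IsProbabilityMeasure P]
    (hS : IsSubordinator P S σ) (hθ0 : 0 < θ) (hθ1 : θ < 1)
    (hK : ∀ l : ℝ, 0 < l → kernelLaplace σ l = l ^ (θ - 1)) (hdx : d = 1 ∨ x ≠ 0)
    {t : ℝ} (ht : 0 < t) :
    IntegrableOn (fun τ => heatKernel x τ * inverseDensity P S t τ) (Ioi 0) := by
  refine ⟨((measurable_heatKernel x).mul (measurable_inverseDensity t)).aestronglyMeasurable, ?_⟩
  rw [hasFiniteIntegral_iff_ofReal (ae_nonneg_heatKernel_mul_inverseDensity t),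
    hS.lintegral_heatKernel_mul_inverseDensity hθ0 hθ1 hK ht]
  exact hS.lsubordinatedKernel_lt_top hK hdx ht

lemma IsSubordinator.subordinatedKernel_eq [IsProbabilityMeasure P]
    (hS : IsSubordinator P S σ) (hθ0 : 0 < θ) (hθ1 : θ < 1)
    (hK : ∀ l : ℝ, 0 < l → kernelLaplace σ l = l ^ (θ - 1)) {t : ℝ} (ht : 0 < t) :
    subordinatedKernel P S x t = (lsubordinatedKernel P S x t).toReal := by
  rw [subordinatedKernel, integral_eq_lintegral_of_nonneg_ae
    (ae_nonneg_heatKernel_mul_inverseDensity t)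
    ((measurable_heatKernel x).mul (measurable_inverseDensity t)).aestronglyMeasurable,
    hS.lintegral_heatKernel_mul_inverseDensity hθ0 hθ1 hK ht]

lemma IsSubordinator.setLIntegral_lsubordinatedKernel_lt_top [IsProbabilityMeasure P]
    (hS : IsSubordinator P S σ)
    (hK : ∀ l : ℝ, 0 < l → kernelLaplace σ l = l ^ (θ - 1)) (hdx : d = 1 ∨ x ≠ 0) (t : ℝ) :
    ∫⁻ s in Ioc 0 t, lsubordinatedKernel P S x s < ∞ := by
  have hV := hS.measurable_lsubordinatedKernel hK (x := x)
  have hlap := hS.lintegral_exp_mul_lsubordinatedKernel hK hdx one_pos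
  calc ∫⁻ s in Ioc 0 t, lsubordinatedKernel P S x s
      ≤ ∫⁻ s in Ioc 0 t, ENNReal.ofReal (Real.exp t) *
          (ENNReal.ofReal (Real.exp (-(1 * s))) * lsubordinatedKernel P S x s) := by
        refine setLIntegral_mono (by fun_prop) fun s hs => ?_
        rw [← mul_assoc, ← ENNReal.ofReal_mul (Real.exp_nonneg _), ← Real.exp_add]
        refine le_mul_of_one_le_left zero_le ?_
        rw [ENNReal.one_le_ofReal, Real.one_le_exp_iff]
        linarith [hs.2]
    _ = ENNReal.ofReal (Real.exp t) * ∫⁻ s in Ioc 0 t,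
          ENNReal.ofReal (Real.exp (-(1 * s))) * lsubordinatedKernel P S x s :=
        lintegral_const_mul _ (by fun_prop)
    _ ≤ ENNReal.ofReal (Real.exp t) * ∫⁻ s in Ioi 0,
          ENNReal.ofReal (Real.exp (-(1 * s))) * lsubordinatedKernel P S x s := by
        gcongr
        exact Ioc_subset_Ioi_self
    _ < ∞ := by
        rw [hlap]
        exact ENNReal.mul_lt_top ENNReal.ofReal_lt_top ENNReal.ofReal_lt_top

lemma IsSubordinator.intervalIntegrable_subordinatedKernel [IsProbabilityMeasure P]
    (hS : IsSubordinator P S σ) (hθ0 : 0 < θ) (hθ1 : θ < 1)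
    (hK : ∀ l : ℝ, 0 < l → kernelLaplace σ l = l ^ (θ - 1)) (hdx : d = 1 ∨ x ≠ 0)
    {t : ℝ} (ht : 0 < t) : IntervalIntegrable (subordinatedKernel P S x) volume 0 t := by
  rw [intervalIntegrable_iff_integrableOn_Ioc_of_le ht.le]
  have h : IntegrableOn (fun s => (lsubordinatedKernel P S x s).toReal) (Ioc 0 t) :=
    integrable_toReal_of_lintegral_ne_top
      (hS.measurable_lsubordinatedKernel hK).aemeasurable
      (hS.setLIntegral_lsubordinatedKernel_lt_top hK hdx t).ne
  refine h.congr_fun (fun s hs => ?_) measurableSet_Ioc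
  exact (hS.subordinatedKernel_eq hθ0 hθ1 hK hs.1).symm

/-! ### Asymptotics of the Cesàro mean -/

/-- The Tauberian step: if the Laplace transform `H` of the heat kernel is regularly varying at `0`
of index `-α`, then the Cesàro mean of the subordinated kernel is asymptotic to a constant multiple
of `t^{-θ} H(t^{-θ})`. -/
lemma IsSubordinator.cesaroMean_isEquivalent [IsProbabilityMeasure P]
    (hS : IsSubordinator P S σ) (hθ0 : 0 < θ) (hθ1 : θ < 1)
    (hK : ∀ l : ℝ, 0 < l → kernelLaplace σ l = l ^ (θ - 1)) (hdx : d = 1 ∨ x ≠ 0)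
    {α : ℝ} (hα : 0 ≤ α)
    (hreg : ∀ c : ℝ, 0 < c →
      Tendsto (fun u => heatLaplace x (c * u) / heatLaplace x u) (𝓝[>] 0) (𝓝 (c ^ (-α)))) :
    (fun t => cesaroMean (subordinatedKernel P S x) t) ~[atTop] fun t =>
      1 / Real.Gamma (2 - θ + θ * α) * (t ^ (-θ) * heatLaplace x (t ^ (-θ))) := by
  have hV := hS.measurable_lsubordinatedKernel hK (x := x)
  set U : Measure ℝ := (volume.restrict (Ioi 0)).withDensity (lsubordinatedKernel P S x) with hUdef
  set Λ : ℝ → ℝ := fun l => l ^ (θ - 1) * heatLaplace x (l ^ θ) with hΛdef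
  have hρ : 0 < 1 - θ + θ * α := by
    have := mul_nonneg hθ0.le hα
    linarith
  have hU0 : ∀ᵐ s ∂U, 0 ≤ s := by
    refine (withDensity_absolutelyContinuous _ _).ae_le ?_
    filter_upwards [ae_restrict_mem measurableSet_Ioi] with s hs using le_of_lt hs
  have hpos : ∀ l, 0 < l → 0 < Λ l := fun l hl =>
    mul_pos (Real.rpow_pos_of_pos hl _) (heatLaplace_pos hdx (Real.rpow_pos_of_pos hl _))
  have hΛ : ∀ l, 0 < l → ∫ s, Real.exp (-(l * s)) ∂U = Λ l := by
    intro l hl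
    rw [integral_eq_lintegral_of_nonneg_ae (Eventually.of_forall fun _ => Real.exp_nonneg _)
      (by fun_prop), hUdef, lintegral_withDensity_eq_lintegral_mul _ hV (by fun_prop)]
    simp only [Pi.mul_apply]
    simp_rw [mul_comm (lsubordinatedKernel P S x _)]
    rw [hS.lintegral_exp_mul_lsubordinatedKernel hK hdx hl, ENNReal.toReal_ofReal (hpos l hl).le]
  have hpow0 : Tendsto (fun l : ℝ => l ^ θ) (𝓝[>] 0) (𝓝[>] 0) := by
    refine tendsto_nhdsWithin_of_tendsto_nhds_of_eventually_within _ ?_ ?_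
    · have := (Real.continuous_rpow_const hθ0.le).tendsto 0
      rw [Real.zero_rpow hθ0.ne'] at this
      exact this.mono_left nhdsWithin_le_nhds
    · filter_upwards [self_mem_nhdsWithin] with l hl using Real.rpow_pos_of_pos hl θ
  have hregΛ : ∀ n : ℕ, Tendsto (fun l => Λ ((n + 1) * l) / Λ l) (𝓝[>] 0)
      (𝓝 (((n : ℝ) + 1) ^ (-(1 - θ + θ * α)))) := by
    intro n
    have hn : (0 : ℝ) < n + 1 := by positivity
    have h1 := ((hreg (((n : ℝ) + 1) ^ θ) (Real.rpow_pos_of_pos hn θ)).comp hpow0).const_mul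
      (((n : ℝ) + 1) ^ (θ - 1))
    rw [← Real.rpow_mul hn.le, ← Real.rpow_add hn,
      show θ - 1 + θ * -α = -(1 - θ + θ * α) by ring] at h1
    refine h1.congr' ?_
    filter_upwards [self_mem_nhdsWithin] with l hl
    have hl : 0 < l := hl
    have h2 := Real.rpow_pos_of_pos hl (θ - 1)
    simp only [hΛdef, Function.comp]
    rw [Real.mul_rpow hn.le hl.le, Real.mul_rpow hn.le hl.le]
    field_simp
  have hkar := (karamata_tauberian hU0 hρ hΛ hpos hregΛ).comp tendsto_inv_atTop_nhdsGT_zero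
  have hG : 0 < Real.Gamma (2 - θ + θ * α) := Real.Gamma_pos_of_pos (by linarith)
  rw [show 1 - θ + θ * α + 1 = 2 - θ + θ * α by ring] at hkar
  refine isEquivalent_of_tendsto_one ?_
  have hkar' := hkar.mul_const (Real.Gamma (2 - θ + θ * α))
  rw [one_div_mul_cancel hG.ne'] at hkar'
  refine hkar'.congr' ?_
  filter_upwards [eventually_gt_atTop 0] with t ht
  have hUt : U.real (Iic t) = ∫ s in (0 : ℝ)..t, subordinatedKernel P S x s := by
    rw [intervalIntegral.integral_of_le ht.le, setIntegral_congr_fun measurableSet_Ioc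
      (g := fun s => (lsubordinatedKernel P S x s).toReal)
      fun s hs => hS.subordinatedKernel_eq hθ0 hθ1 hK hs.1,
      integral_toReal hV.aemeasurable, measureReal_def, hUdef,
      withDensity_apply _ measurableSet_Iic, Measure.restrict_restrict measurableSet_Iic,
      inter_comm, Ioi_inter_Iic]
    filter_upwards [ae_restrict_mem measurableSet_Ioc] with s hs
    exact hS.lsubordinatedKernel_lt_top hK hdx hs.1
  have hti : (t⁻¹ : ℝ) ^ (θ - 1) = t * t ^ (-θ) := by
    rw [Real.inv_rpow ht.le, ← Real.rpow_neg ht.le, neg_sub, sub_eq_add_neg, Real.rpow_add ht,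
      Real.rpow_one]
  have hti' : (t⁻¹ : ℝ) ^ θ = t ^ (-θ) := by rw [Real.inv_rpow ht.le, ← Real.rpow_neg ht.le]
  have hH := heatLaplace_pos hdx (Real.rpow_pos_of_pos ht (-θ))
  have htp := Real.rpow_pos_of_pos ht (-θ)
  simp only [Function.comp, hΛdef, Pi.div_apply]
  rw [one_div, inv_inv, hUt, hti, hti', cesaroMean]
  field_simp

lemma tendsto_rpow_neg_atTop_nhdsGT {a : ℝ} (ha : 0 < a) :
    Tendsto (fun t : ℝ => t ^ (-a)) atTop (𝓝[>] 0) := by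
  refine tendsto_nhdsWithin_of_tendsto_nhds_of_eventually_within _ (tendsto_rpow_neg_atTop ha) ?_
  filter_upwards [eventually_gt_atTop 0] with t ht using Real.rpow_pos_of_pos ht _

lemma sqrt_rpow_neg (t : ℝ) (ht : 0 < t) : Real.sqrt (t ^ (-θ)) = t ^ (-(θ / 2)) := by
  rw [Real.sqrt_eq_rpow, ← Real.rpow_mul ht.le]
  congr 1
  ring

lemma IsSubordinator.cesaroMean_isEquivalent_one [IsProbabilityMeasure P]
    (hS : IsSubordinator P S σ) (hθ0 : 0 < θ) (hθ1 : θ < 1)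
    (hK : ∀ l : ℝ, 0 < l → kernelLaplace σ l = l ^ (θ - 1)) (x : EuclideanSpace ℝ (Fin 1)) :
    (fun t => cesaroMean (subordinatedKernel P S x) t) ~[atTop] fun t =>
      1 / (Real.sqrt 2 * Real.Gamma (2 - θ / 2)) * t ^ (-(θ / 2)) := by
  have h2 : 0 < Real.sqrt 2 := Real.sqrt_pos.2 (by norm_num)
  have hlim := tendsto_heatLaplace_one x
  have hreg : ∀ c : ℝ, 0 < c → Tendsto (fun u => heatLaplace x (c * u) / heatLaplace x u) (𝓝[>] 0)
      (𝓝 (c ^ (-((1 : ℝ) / 2)))) := by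
    intro c hc
    have h := ((hlim.comp (tendsto_const_mul_nhdsGT_zero hc)).div hlim (by positivity)).const_mul
      (c ^ (-((1 : ℝ) / 2)))
    rw [div_self (by positivity), mul_one] at h
    refine h.congr' ?_
    filter_upwards [self_mem_nhdsWithin] with u hu
    have hu : 0 < u := hu
    have h3 := Real.rpow_pos_of_pos hu ((1 : ℝ) / 2)
    have h4 := Real.rpow_pos_of_pos hc ((1 : ℝ) / 2)
    have h5 := heatLaplace_pos (x := x) (Or.inl rfl) hu
    simp only [Function.comp, Pi.div_apply]
    rw [Real.mul_rpow hc.le hu.le, Real.rpow_neg hc.le]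
    field_simp
  refine (hS.cesaroMean_isEquivalent hθ0 hθ1 hK (Or.inl rfl) (by norm_num) hreg).trans ?_
  refine isEquivalent_of_tendsto_one ?_
  have h := (hlim.comp (tendsto_rpow_neg_atTop_nhdsGT hθ0)).const_mul (Real.sqrt 2)
  rw [mul_one_div_cancel h2.ne'] at h
  refine h.congr' ?_
  filter_upwards [eventually_gt_atTop 0] with t ht
  have hG : 0 < Real.Gamma (2 - θ / 2) := Real.Gamma_pos_of_pos (by linarith)
  have h3 := Real.rpow_pos_of_pos ht (-(θ / 2))
  have h4 : t ^ (-θ) = t ^ (-(θ / 2)) * t ^ (-(θ / 2)) := by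
    rw [← Real.rpow_add ht]
    congr 1
    ring
  simp only [Function.comp, Pi.div_apply]
  rw [← Real.sqrt_eq_rpow, sqrt_rpow_neg t ht, show 2 - θ + θ * (1 / 2) = 2 - θ / 2 by ring]
  generalize heatLaplace x (t ^ (-θ)) = H
  rw [h4, one_div, one_div]
  generalize Real.Gamma (2 - θ / 2) = G at hG ⊢
  field_simp

lemma IsSubordinator.cesaroMean_isEquivalent_two [IsProbabilityMeasure P]
    (hS : IsSubordinator P S σ) (hθ0 : 0 < θ) (hθ1 : θ < 1)
    (hK : ∀ l : ℝ, 0 < l → kernelLaplace σ l = l ^ (θ - 1)) {x : EuclideanSpace ℝ (Fin 2)}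
    (hx : x ≠ 0) :
    (fun t => cesaroMean (subordinatedKernel P S x) t) ~[atTop] fun t =>
      1 / (Real.pi * Real.Gamma (2 - θ)) * t ^ (-θ) *
        besselK 0 (Real.sqrt 2 * ‖x‖ * t ^ (-(θ / 2))) := by
  have hx0 : 0 < ‖x‖ := norm_pos_iff.2 hx
  have hpi := Real.pi_pos
  have h2 : 0 < Real.sqrt 2 := Real.sqrt_pos.2 (by norm_num)
  have hH : ∀ u, 0 < u → heatLaplace x u =
      1 / Real.pi * besselK 0 (Real.sqrt 2 * ‖x‖ * Real.sqrt u) := by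
    intro u hu
    rw [heatLaplace_eq_besselK hx hu]
    norm_num
    rw [Real.rpow_neg_one]
    left
    field_simp
  have hz0 : Tendsto (fun u => Real.sqrt 2 * ‖x‖ * Real.sqrt u) (𝓝[>] 0) (𝓝[>] 0) := by
    refine (tendsto_const_mul_nhdsGT_zero (by positivity)).comp ?_
    refine tendsto_nhdsWithin_of_tendsto_nhds_of_eventually_within _ ?_ ?_
    · have := Real.continuous_sqrt.tendsto 0
      rw [Real.sqrt_zero] at this
      exact this.mono_left nhdsWithin_le_nhds
    · filter_upwards [self_mem_nhdsWithin] with u hu using Real.sqrt_pos.2 hu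
  have hreg : ∀ c : ℝ, 0 < c → Tendsto (fun u => heatLaplace x (c * u) / heatLaplace x u) (𝓝[>] 0)
      (𝓝 (c ^ (-(0 : ℝ)))) := by
    intro c hc
    rw [neg_zero, Real.rpow_zero]
    refine ((tendsto_besselK_zero_ratio (Real.sqrt_pos.2 hc)).comp hz0).congr' ?_
    filter_upwards [self_mem_nhdsWithin] with u hu
    have hu : 0 < u := hu
    rw [hH u hu, hH _ (mul_pos hc hu), Real.sqrt_mul hc.le]
    simp only [Function.comp]
    rw [mul_div_mul_left _ _ (by positivity)]
    congr 2
    ring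
  refine (hS.cesaroMean_isEquivalent hθ0 hθ1 hK (Or.inr hx) le_rfl hreg).congr_right ?_
  filter_upwards [eventually_gt_atTop 0] with t ht
  have hG : 0 < Real.Gamma (2 - θ) := Real.Gamma_pos_of_pos (by linarith)
  rw [hH _ (Real.rpow_pos_of_pos ht _), sqrt_rpow_neg t ht, mul_zero, add_zero]
  field_simp

lemma IsSubordinator.cesaroMean_isEquivalent_three [IsProbabilityMeasure P]
    (hS : IsSubordinator P S σ) (hθ0 : 0 < θ) (hθ1 : θ < 1)
    (hK : ∀ l : ℝ, 0 < l → kernelLaplace σ l = l ^ (θ - 1)) (hd : 3 ≤ d) (hx : x ≠ 0) :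
    (fun t => cesaroMean (subordinatedKernel P S x) t) ~[atTop] fun t =>
      1 / Real.Gamma (2 - θ) * (t ^ (-θ) * heatLaplace x (t ^ (-θ))) := by
  have hlim := tendsto_heatLaplace_of_three_le hd hx
  have hpos := setIntegral_Ioi_pos (integrableOn_heatKernel hd hx) fun _ hτ => heatKernel_pos x hτ
  have h := hS.cesaroMean_isEquivalent hθ0 hθ1 hK (Or.inr hx) le_rfl (x := x) fun c hc => by
    have h := (hlim.comp (tendsto_const_mul_nhdsGT_zero hc)).div hlim hpos.ne'
    rw [div_self hpos.ne'] at h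
    rw [neg_zero, Real.rpow_zero]
    exact h
  simpa only [mul_zero, add_zero] using h

end Subordinated

theorem mainTheorem1 (θ : ℝ) (hθ0 : 0 < θ) (hθ1 : θ < 1) :
    ∃ (C₁ C₂ : ℝ) (A B : ℕ → ℝ), 0 < C₁ ∧ 0 < C₂ ∧ (∀ d, 3 ≤ d → 0 < A d ∧ 0 < B d) ∧
      ∀ {Ω : Type*} [MeasurableSpace Ω] (P : Measure Ω) [IsProbabilityMeasure P]
        (S : ℝ≥0 → Ω → ℝ) (σ : Measure ℝ), IsSubordinator P S σ →
        (∀ l : ℝ, 0 < l → kernelLaplace σ l = l ^ (θ - 1)) →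
        -- `E(t)` has a density, and the integrals that define `v^E` and its mean converge
        (∀ t : ℝ, 0 < t → P.map (inverseProcess S t) ≪ volume) ∧
        (∀ d : ℕ, 1 ≤ d → ∀ x : EuclideanSpace ℝ (Fin d), (d = 1 ∨ x ≠ 0) →
          ∀ t : ℝ, 0 < t →
            IntegrableOn (fun τ => heatKernel x τ * inverseDensity P S t τ) (Ioi 0) ∧
            IntervalIntegrable (subordinatedKernel P S x) volume 0 t) ∧
        -- dimension one
        (∀ x : EuclideanSpace ℝ (Fin 1),
          (fun t => cesaroMean (subordinatedKernel P S x) t) ~[atTop]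
            (fun t => C₁ * t ^ (-(θ / 2)) *
              Real.exp (-(Real.sqrt 2 * ‖x‖ * t ^ (-(θ / 2))))) ∧
          (fun t => cesaroMean (subordinatedKernel P S x) t) ~[atTop]
            (fun t => C₁ * t ^ (-(θ / 2)))) ∧
        -- dimension two
        (∀ x : EuclideanSpace ℝ (Fin 2), x ≠ 0 →
          (fun t => cesaroMean (subordinatedKernel P S x) t) ~[atTop]
            (fun t => C₂ * t ^ (-θ) * besselK 0 (Real.sqrt 2 * ‖x‖ * t ^ (-(θ / 2)))) ∧
          (fun t => cesaroMean (subordinatedKernel P S x) t) ~[atTop]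
            (fun t => -C₂ * t ^ (-θ) * Real.log (Real.sqrt 2 * ‖x‖ * t ^ (-(θ / 2))))) ∧
        -- dimension at least three
        (∀ d : ℕ, 3 ≤ d → ∀ x : EuclideanSpace ℝ (Fin d), x ≠ 0 →
          (fun t => cesaroMean (subordinatedKernel P S x) t) ~[atTop]
            (fun t => A d * t ^ (-θ) *
              (‖x‖ ^ ((2 - (d : ℝ)) / 2) * t ^ (θ * (2 - (d : ℝ)) / 4) *
                besselK ((d : ℝ) / 2 - 1) (Real.sqrt 2 * ‖x‖ * t ^ (-(θ / 2))))) ∧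
          (fun t => cesaroMean (subordinatedKernel P S x) t) ~[atTop]
            (fun t => B d * ‖x‖ ^ (2 - (d : ℝ)) * t ^ (-θ))) := by
  have hpi := Real.pi_pos
  have h2 : 0 < Real.sqrt 2 := Real.sqrt_pos.2 (by norm_num)
  have hG1 : 0 < Real.Gamma (2 - θ / 2) := Real.Gamma_pos_of_pos (by linarith)
  have hG2 : 0 < Real.Gamma (2 - θ) := Real.Gamma_pos_of_pos (by linarith)
  -- the constants are the asymptotic coefficients of `H` (and for `A d` the factor in front of the
  -- Bessel function) divided by the Gamma factor of the Tauberian theorem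
  refine ⟨1 / (Real.sqrt 2 * Real.Gamma (2 - θ / 2)), 1 / (Real.pi * Real.Gamma (2 - θ)),
    fun d => 2 * (2 * Real.pi) ^ (-((d : ℝ) / 2)) * Real.sqrt 2 ^ ((d : ℝ) / 2 - 1) /
      Real.Gamma (2 - θ),
    fun d => newtonConst d / Real.Gamma (2 - θ), by positivity, by positivity,
    fun d hd => ⟨by positivity, div_pos (newtonConst_pos hd) hG2⟩, ?_⟩
  intro Ω _ P _ S σ hS hK
  refine ⟨fun t ht => hS.map_inverseProcess_absolutelyContinuous hθ0 hθ1 hK ht,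
    fun d _ x hdx t ht => ⟨hS.integrableOn_heatKernel_mul_inverseDensity hθ0 hθ1 hK hdx ht,
      hS.intervalIntegrable_subordinatedKernel hθ0 hθ1 hK hdx ht⟩, fun x => ?_, fun x hx => ?_,
    fun d hd x hx => ?_⟩
  · have h := hS.cesaroMean_isEquivalent_one hθ0 hθ1 hK x
    refine ⟨?_, h⟩
    have hexp : Tendsto (fun t : ℝ => Real.exp (-(Real.sqrt 2 * ‖x‖ * t ^ (-(θ / 2))))) atTop
        (𝓝 1) := by
      have h3 := ((tendsto_rpow_neg_atTop (half_pos hθ0)).const_mul (Real.sqrt 2 * ‖x‖)).neg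
      rw [mul_zero, neg_zero] at h3
      have h4 := (Real.continuous_exp.tendsto 0).comp h3
      rwa [Real.exp_zero] at h4
    have h5 := h.mul ((isEquivalent_const_iff_tendsto one_ne_zero).2 hexp).symm
    simpa [Pi.mul_def] using h5
  · have h := hS.cesaroMean_isEquivalent_two hθ0 hθ1 hK hx
    have hx0 : 0 < ‖x‖ := norm_pos_iff.2 hx
    refine ⟨h, h.trans ?_⟩
    have h3 := besselK_zero_isEquivalent.comp_tendsto
      ((tendsto_const_mul_nhdsGT_zero (mul_pos h2 hx0)).comp
        (tendsto_rpow_neg_atTop_nhdsGT (half_pos hθ0)))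
    have h4 := (IsEquivalent.refl (u := fun t : ℝ => 1 / (Real.pi * Real.Gamma (2 - θ)) * t ^ (-θ))
      (l := atTop)).mul h3
    refine h4.congr_right (Eventually.of_forall fun t => ?_)
    simp only [Pi.mul_apply, Function.comp]
    ring
  · have h := hS.cesaroMean_isEquivalent_three hθ0 hθ1 hK hd hx
    have hx0 : 0 < ‖x‖ := norm_pos_iff.2 hx
    refine ⟨h.congr_right ?_, h.trans ?_⟩
    · filter_upwards [eventually_gt_atTop 0] with t ht
      have htp := Real.rpow_pos_of_pos ht (-(θ / 2))
      have e1 : (‖x‖ / (Real.sqrt 2 * t ^ (-(θ / 2)))) ^ (1 - (d : ℝ) / 2) =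
          Real.sqrt 2 ^ ((d : ℝ) / 2 - 1) *
            (‖x‖ ^ ((2 - (d : ℝ)) / 2) * t ^ (θ * (2 - (d : ℝ)) / 4)) := by
        rw [Real.div_rpow hx0.le (by positivity), Real.mul_rpow h2.le htp.le, div_eq_mul_inv,
          mul_inv, ← Real.rpow_neg h2.le, ← Real.rpow_mul ht.le, ← Real.rpow_neg ht.le]
        ring_nf
      rw [heatLaplace_eq_besselK hx (Real.rpow_pos_of_pos ht _), sqrt_rpow_neg t ht, e1]
      field_simp
    · have hI : ∫ τ in Ioi 0, heatKernel x τ ≠ 0 :=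
        (setIntegral_Ioi_pos (integrableOn_heatKernel hd hx) fun _ hτ => heatKernel_pos x hτ).ne'
      have h3 := (isEquivalent_const_iff_tendsto hI).2
        ((tendsto_heatLaplace_of_three_le hd hx).comp (tendsto_rpow_neg_atTop_nhdsGT hθ0))
      have h4 := (IsEquivalent.refl (u := fun t : ℝ => 1 / Real.Gamma (2 - θ) * t ^ (-θ))
        (l := atTop)).mul h3
      refine (h4.congr_left (Eventually.of_forall fun t => ?_)).congr_right
        (Eventually.of_forall fun t => ?_)
      · simp only [Pi.mul_apply, Function.comp]
        ring
      · simp only [Pi.mul_apply, integral_heatKernel hx, Function.const_apply]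
        ring
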